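/- Let $\mathfrak{w}_n$ be the Lie algebra of all derivations of $\mathbb{C}[x_1,\dots,x_n]$, with basis $D_i(\mathbf m)=x_1^{m_1}\cdots x_n^{m_n}\frac{\partial}{\partial x_i}$ ($1\le i\le n$, $\mathbf m\in\mathbb{Z}_{\ge 0}^n$). Let $\mathfrak h$ be the span of the elements $x_i\frac{\partial}{\partial x_i}$, let $\mathfrak a\cong\mathfrak{gl}_n$ be the span of the elements $x_i\frac{\partial}{\partial x_j}$, and fix a triangular decomposition $\mathfrak a=\mathfrak n_-^{\mathfrak a}\oplus\mathfrak h\oplus\mathfrak n_+^{\mathfrak a}$. Let $\mathfrak n_+$ be the (finite-dimensional) span of $\mathfrak n_+^{\mathfrak a}$ and all $\frac{\partial}{\partial x_i}$, and let $\mathfrak n_-$ be the span of $\mathfrak n_-^{\mathfrak a}$ and all $D_i(\mathbf m)$ that lie neither in $\mathfrak a$ nor in $\mathfrak n_+$, so that $\mathfrak w_n=\mathfrak n_-\oplus\mathfrak h\oplus\mathfrak n_+$ is a direct sum of Lie subalgebras. For $\mu\in\mathfrak h^*$ let $M^{\pm}(\mu)=U(\mathfrak w_n)\otimes_{U(\mathfrak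 h\oplus\mathfrak n_\pm)}\mathbb{C}_\mu$, where $\mathfrak h$ acts on $\mathbb{C}_\mu=\mathbb{C}$ by $\mu$ and $\mathfrak n_\pm$ acts by $0$, let $L^+(\mu)$ be the unique simple quotient of $M^+(\mu)$, and let $\overline{L^+(\mu)}=\prod_{\nu\in\mathfrak h^*}L^+(\mu)_\nu$ be the product of its weight spaces with the natural $\mathfrak w_n$-action. For a Lie algebra homomorphism $\lambda:\mathfrak n_+\to\mathbb{C}$ and a $\mathfrak w_n$-module $M$ put $W_\lambda(M)=\{v\in M: xv=\lambda(x)v \text{ for all } x\in\mathfrak n_+\}$, and let $M_\lambda=U(\mathfrak w_n)\otimes_{U(\mathfrak n_+)}\mathbb{C}_\lambda$. Assume that $\mu\in\mathfrak h^*$ is such that $M^-(-\mu)$ is simple. Then for every Lie algebra homomorphism $\lambda:\mathfrak n_+\to\mathbb{C}$: 1. $\dim W_\lambda(\overline{L^+(\mu)})=1$; in particular, $W_\lambda(\overline{L^+(\mu)})$ is a simple $\mathfrak n_+$-module. 2. There is a unique (up to a nonzero scalar) nonzero $\mathfrak w_n$-homomorphism $M_\lambda\to\overline{L^+(\mu)}$.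 Its image $L(\lambda,\mu)$ is a simple $\mathfrak w_n$-module and satisfies $\dim W_\lambda(L(\lambda,\mu))=1$. 3. $\mathrm{Ann}_{U(\mathfrak w_n)}L(\lambda,\mu)=\mathrm{Ann}_{U(\mathfrak w_n)}L^+(\mu)$. -/

import Mathlib

noncomputable section

open scoped TensorProduct

attribute [local instance 100] LieRing.ofAssociativeRing

namespace WittWhittaker

/-! ### Generalities on modules over complex Lie algebras -/

section General

variable {g : Type} [LieRing g] [LieAlgebra ℂ g]

/-- The universal enveloping algebra `U(g)`. -/
abbrev U (g : Type) [LieRing g] [LieAlgebra ℂ g] : Type := UniversalEnvelopingAlgebra ℂ g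

/-- The canonical map `g → U(g)`. -/
abbrev toU (x : g) : U g := UniversalEnvelopingAlgebra.ι ℂ x

/-- The one-dimensional module `ℂ_χ` of a Lie algebra `b` attached to a character `χ` of `b`. -/
def CharModule {b : Type} [LieRing b] [LieAlgebra ℂ b]
    (_χ : LieAlgebra.LieCharacter ℂ b) : Type := ℂ

namespace CharModule

variable {b : Type} [LieRing b] [LieAlgebra ℂ b] (χ : LieAlgebra.LieCharacter ℂ b)

instance : AddCommGroup (CharModule χ) := inferInstanceAs (AddCommGroup ℂ)

instance : Module ℂ (CharModule χ) := inferInstanceAs (Module ℂ ℂ)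

instance : LieRingModule b (CharModule χ) where
  bracket x v := χ x • v
  add_lie x y v := by
    rw [map_add, add_smul]
  lie_add x v w := smul_add (χ x) v w
  leibniz_lie x y v := by
    change χ x • χ y • v = χ ⁅x, y⁆ • v + χ y • χ x • v
    rw [LieAlgebra.lieCharacter_apply_lie, zero_smul, zero_add, smul_comm]

theorem lie_def (x : b) (v : CharModule χ) : ⁅x, v⁆ = χ x • v := rfl

instance : LieModule ℂ b (CharModule χ) where
  smul_lie t x v := by
    rw [lie_def, lie_def, map_smul, smul_assoc]
  lie_smul t x v := by
    rw [lie_def, lie_def, smul_comm]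

end CharModule

/-- The relations `u x ⊗ v = u ⊗ x v`, for `u ∈ U(g)`, `x ∈ b`, `v ∈ V`, that define the tensor
product over `U(b)`; their linear span is stable under left multiplication by `U(g)`. -/
def indRel (b : LieSubalgebra ℂ g) (V : Type) [AddCommGroup V] [Module ℂ V]
    [LieRingModule b V] : Submodule (U g) (U g ⊗[ℂ] V) :=
  Submodule.span (U g)
    {t | ∃ (u : U g) (x : b) (v : V), t = (u * toU (x : g)) ⊗ₜ[ℂ] v - u ⊗ₜ[ℂ] ⁅x, v⁆}

/-- The induced module `U(g) ⊗_{U(b)} V`. -/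
def Ind (b : LieSubalgebra ℂ g) (V : Type) [AddCommGroup V] [Module ℂ V]
    [LieRingModule b V] : Type :=
  (U g ⊗[ℂ] V) ⧸ indRel b V

namespace Ind

variable (b : LieSubalgebra ℂ g) (V : Type) [AddCommGroup V] [Module ℂ V] [LieRingModule b V]

instance : AddCommGroup (Ind b V) := inferInstanceAs (AddCommGroup ((U g ⊗[ℂ] V) ⧸ indRel b V))

instance : Module (U g) (Ind b V) := inferInstanceAs (Module (U g) ((U g ⊗[ℂ] V) ⧸ indRel b V))

instance : Module ℂ (Ind b V) := inferInstanceAs (Module ℂ ((U g ⊗[ℂ] V) ⧸ indRel b V))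

instance : IsScalarTower ℂ (U g) (Ind b V) :=
  inferInstanceAs (IsScalarTower ℂ (U g) ((U g ⊗[ℂ] V) ⧸ indRel b V))

/-- `g` acts on the induced module by left multiplication in `U(g)`. -/
instance : LieRingModule g (Ind b V) where
  bracket x m := toU x • m
  add_lie x y m := by
    rw [toU, map_add, add_smul]
  lie_add x m m' := smul_add (toU x) m m'
  leibniz_lie x y m := by
    change toU x • toU y • m = toU ⁅x, y⁆ • m + toU y • toU x • m
    simp only [toU, LieHom.map_lie, LieRing.of_associative_ring_bracket, sub_smul, mul_smul,
      sub_add_cancel]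

theorem lie_def (x : g) (m : Ind b V) : ⁅x, m⁆ = toU x • m := rfl

instance : LieModule ℂ g (Ind b V) where
  smul_lie t x m := by
    rw [lie_def, lie_def, toU, map_smul, smul_assoc]
  lie_smul t x m := by
    rw [lie_def, lie_def, smul_algebra_smul_comm]

end Ind

/-- The annihilator `Ann_{U(g)} M` of a `g`-module `M`, i.e. the kernel of the algebra
homomorphism `U(g) → End_ℂ M` that extends the action of `g`. -/
def annihilator (g : Type) [LieRing g] [LieAlgebra ℂ g] (M : Type) [AddCommGroup M] [Module ℂ M]
    [LieRingModule g M] [LieModule ℂ g M] : Ideal (U g) :=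
  RingHom.ker (UniversalEnvelopingAlgebra.lift ℂ (LieModule.toEnd ℂ g M))

/-- The space `W_χ(M)` of `χ`-Whittaker vectors (including `0`) of a `g`-module `M`, where `χ` is
a character of a subalgebra `a` of `g`, as an `a`-submodule of `M`. -/
def whittaker {a : LieSubalgebra ℂ g} (χ : LieAlgebra.LieCharacter ℂ a)
    (M : Type) [AddCommGroup M] [Module ℂ M] [LieRingModule g M] [LieModule ℂ g M] :
    LieSubmodule ℂ a M where
  carrier := {v | ∀ x : a, ⁅x, v⁆ = χ x • v}
  add_mem' {v w} hv hw x := by rw [lie_add, hv x, hw x, smul_add]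
  zero_mem' x := by rw [lie_zero, smul_zero]
  smul_mem' t v hv x := by rw [lie_smul, hv x, smul_comm]
  lie_mem {y v} hv x := by
    have hv' : ∀ x : a, ⁅x, v⁆ = χ x • v := hv
    rw [hv' y, lie_smul, hv' x, smul_comm]

end General

/-! ### The Witt algebra -/

/-- The Witt algebra of all derivations of `ℂ[x₁, …, xₙ]`. -/
abbrev Witt (n : ℕ) : Type :=
  Derivation ℂ (MvPolynomial (Fin n) ℂ) (MvPolynomial (Fin n) ℂ)

/-- Pairs `(i, m)`, indexing the derivations `D_i(m)`. -/
abbrev Idx (n : ℕ) : Type := Fin n × (Fin n →₀ ℕ)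

/-- The exponent vector `e_i` of the monomial `x_i`. -/
abbrev e {n : ℕ} (i : Fin n) : Fin n →₀ ℕ := Finsupp.single i 1

variable {n : ℕ}

/-- The derivation `D_i(m) = x^m ∂/∂x_i`, for `p = (i, m)`. -/
def D (p : Idx n) : Witt n := MvPolynomial.monomial p.2 (1 : ℂ) • MvPolynomial.pderiv p.1

theorem D_X (p : Idx n) (j : Fin n) :
    D p (MvPolynomial.X j) = if j = p.1 then MvPolynomial.monomial p.2 1 else 0 := by
  by_cases h : j = p.1
  · subst h; simp [D]
  · simp [D, MvPolynomial.pderiv_X_of_ne h, h]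

theorem D_monomial (p : Idx n) (s : Fin n →₀ ℕ) :
    D p (MvPolynomial.monomial s 1) =
      (s p.1 : ℂ) • MvPolynomial.monomial (p.2 + s - e p.1) 1 := by
  by_cases h : s p.1 = 0
  · simp [D, h]
  · have hs : p.2 + (s - e p.1) = p.2 + s - e p.1 := by
      ext k
      by_cases hk : p.1 = k
      · subst hk; simp; omega
      · simp [Finsupp.single_eq_of_ne' hk]
    simp only [D, Derivation.coe_smul, Pi.smul_apply, MvPolynomial.pderiv_monomial, smul_eq_mul,
      MvPolynomial.monomial_mul, hs, MvPolynomial.smul_monomial]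
    simp

theorem lie_D (p q : Idx n) :
    ⁅D p, D q⁆ = (q.2 p.1 : ℂ) • D (q.1, p.2 + q.2 - e p.1)
      - (p.2 q.1 : ℂ) • D (p.1, p.2 + q.2 - e q.1) := by
  apply MvPolynomial.derivation_ext
  intro j
  rw [Derivation.commutator_apply, D_X, D_X, Derivation.sub_apply, Derivation.smul_apply,
    Derivation.smul_apply, D_X, D_X]
  congr 1
  · split_ifs
    · rw [D_monomial]
    · simp
  · split_ifs
    · rw [D_monomial, add_comm q.2]
    · simp

/-- The natural basis `{D_i(m)}` of the Witt algebra. -/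
def wittBasis (n : ℕ) : Module.Basis (Idx n) ℂ (Witt n) :=
  ((Pi.basis fun _ : Fin n => MvPolynomial.basisMonomials (Fin n) ℂ).map
    (MvPolynomial.mkDerivationEquiv ℂ)).reindex (Equiv.sigmaEquivProd _ _)

theorem wittBasis_apply (p : Idx n) : wittBasis n p = D p := by
  apply MvPolynomial.derivation_ext
  intro j
  rw [D_X]
  obtain ⟨i, m⟩ := p
  simp [wittBasis, MvPolynomial.mkDerivationEquiv, MvPolynomial.mkDerivation_X, Pi.single_apply]

theorem lie_mem_of_mem_span {g : Type} [LieRing g] [LieAlgebra ℂ g] {T : Set g}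
    {P : Submodule ℂ g} (h : ∀ x ∈ T, ∀ y ∈ T, ⁅x, y⁆ ∈ P) {x y : g}
    (hx : x ∈ Submodule.span ℂ T) (hy : y ∈ Submodule.span ℂ T) : ⁅x, y⁆ ∈ P := by
  induction hx, hy using Submodule.span_induction₂ with
  | mem_mem x y hx hy => exact h x hx y hy
  | zero_left y hy => simp
  | zero_right x hx => simp
  | add_left x y z _ _ _ h1 h2 => rw [add_lie]; exact Submodule.add_mem _ h1 h2
  | add_right x y z _ _ _ h1 h2 => rw [lie_add]; exact Submodule.add_mem _ h1 h2
  | smul_left r x y _ _ h => rw [smul_lie]; exact Submodule.smul_mem _ _ h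
  | smul_right r x y _ _ h => rw [lie_smul]; exact Submodule.smul_mem _ _ h

/-- The condition on a set `S` of indices that makes the span of the `D_i(m)`, `(i, m) ∈ S`,
closed under the bracket. -/
def IsClosedIdx (S : Set (Idx n)) : Prop :=
  ∀ p ∈ S, ∀ q ∈ S, q.2 p.1 ≠ 0 → (q.1, p.2 + q.2 - e p.1) ∈ S

/-- The linear span of the elements `D_i(m)` with `(i, m) ∈ S`, as a Lie subalgebra. -/
def spanD (S : Set (Idx n)) (hS : IsClosedIdx S) :
    LieSubalgebra ℂ (Witt n) where
  toSubmodule := Submodule.span ℂ (D '' S)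
  lie_mem' {x y} hx hy := by
    refine lie_mem_of_mem_span ?_ hx hy
    rintro _ ⟨p, hp, rfl⟩ _ ⟨q, hq, rfl⟩
    change ⁅D p, D q⁆ ∈ _
    rw [lie_D]
    refine Submodule.sub_mem _ ?_ ?_
    · by_cases h : q.2 p.1 = 0
      · simp [h]
      · exact Submodule.smul_mem _ _ (Submodule.subset_span ⟨_, hS p hp q hq h, rfl⟩)
    · by_cases h : p.2 q.1 = 0
      · simp [h]
      · refine Submodule.smul_mem _ _ (Submodule.subset_span ⟨_, ?_, rfl⟩)
        rw [add_comm p.2]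
        exact hS q hq p hp h

/-! ### The subalgebras `𝔥`, `𝔫₊`, `𝔫₋` -/

/-- Indices of the elements `x_i ∂/∂x_i`. -/
def cartanIdx (n : ℕ) : Set (Idx n) := {p | p.2 = e p.1}

/-- Indices of the elements `∂/∂x_i` and of the root vectors `x_j ∂/∂x_i` with `r j i`. -/
def posIdx (r : Fin n → Fin n → Prop) : Set (Idx n) :=
  {p | p.2 = 0 ∨ ∃ j, r j p.1 ∧ p.2 = e j}

/-- Indices of the root vectors `x_j ∂/∂x_i` with `r i j` and of all `D_i(m)` that lie neither in
`𝔤𝔩ₙ` nor in `𝔫₊`, i.e. such that `m` has total degree at least two. -/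
def negIdx (r : Fin n → Fin n → Prop) : Set (Idx n) :=
  {p | (∃ j, r p.1 j ∧ p.2 = e j) ∨ 2 ≤ p.2.degree}

theorem e_apply (i j : Fin n) : e i j = if i = j then 1 else 0 := Finsupp.single_apply

theorem eq_of_e_apply_ne {i j : Fin n} (h : e i j ≠ 0) : i = j := by
  by_contra hij
  exact h (by rw [e_apply, if_neg hij])

theorem e_injective {i j : Fin n} (h : (e i : Fin n →₀ ℕ) = e j) : i = j := by
  refine (eq_of_e_apply_ne (i := j) (j := i) ?_).symm
  rw [← h, e_apply, if_pos rfl]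
  exact one_ne_zero

theorem degree_e (i : Fin n) : (e i).degree = 1 := Finsupp.degree_single i 1

theorem eq_e_add {m : Fin n →₀ ℕ} {i : Fin n} (h : m i ≠ 0) : ∃ k, m = e i + k := by
  refine ⟨m - e i, ?_⟩
  ext j
  have := e_apply i j
  simp only [Finsupp.add_apply, Finsupp.tsub_apply]
  split_ifs at this with hij
  · subst hij; omega
  · omega

theorem add_e_add_sub (a k : Fin n →₀ ℕ) (i : Fin n) : a + (e i + k) - e i = a + k := by
  rw [add_left_comm, add_tsub_cancel_left]

theorem closed_cartanIdx : IsClosedIdx (cartanIdx n) := by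
  rintro ⟨i, m⟩ hp ⟨j, k⟩ hq h
  simp only [cartanIdx, Set.mem_ofPred_eq] at hp hq h ⊢
  subst hp hq
  obtain rfl := eq_of_e_apply_ne h
  simp

section Order

variable (r : Fin n → Fin n → Prop) [IsStrictTotalOrder (Fin n) r]

theorem closed_posIdx : IsClosedIdx (posIdx r) := by
  rintro ⟨i, m⟩ hp ⟨j, k⟩ hq h
  simp only [posIdx, Set.mem_ofPred_eq] at hp hq h ⊢
  rcases hq with rfl | ⟨l, hl, rfl⟩
  · simp at h
  · obtain rfl := eq_of_e_apply_ne h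
    rw [add_tsub_cancel_right]
    rcases hp with rfl | ⟨l', hl', rfl⟩
    · exact Or.inl rfl
    · exact Or.inr ⟨l', _root_.trans hl' hl, rfl⟩

theorem closed_negIdx : IsClosedIdx (negIdx r) := by
  rintro ⟨i, m⟩ hp ⟨j, k⟩ hq h
  simp only [negIdx, Set.mem_ofPred_eq] at hp hq h ⊢
  rcases hq with ⟨l, hl, rfl⟩ | hq
  · obtain rfl := eq_of_e_apply_ne h
    rw [add_tsub_cancel_right]
    rcases hp with ⟨l', hl', rfl⟩ | hp
    · exact Or.inl ⟨l', _root_.trans hl hl', rfl⟩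
    · exact Or.inr hp
  · right
    obtain ⟨k, rfl⟩ := eq_e_add h
    rw [add_e_add_sub, map_add]
    rw [map_add, degree_e] at hq
    have : 1 ≤ m.degree := by
      rcases hp with ⟨l', hl', rfl⟩ | hp
      · rw [degree_e]
      · omega
    omega

theorem closed_union {S : Set (Idx n)} (hS : IsClosedIdx S) : IsClosedIdx (cartanIdx n ∪ S) := by
  intro p hp q hq h
  by_cases hpc : p ∈ cartanIdx n
  · have hpc' : p.2 = e p.1 := hpc
    rw [hpc', add_tsub_cancel_left]
    exact hq
  · by_cases hqc : q ∈ cartanIdx n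
    · have hqc' : q.2 = e q.1 := hqc
      rw [hqc'] at h ⊢
      rw [eq_of_e_apply_ne h, add_tsub_cancel_right]
      exact hp
    · exact Or.inr (hS p (hp.resolve_left hpc) q (hq.resolve_left hqc) h)

theorem posIdx_disjoint {p : Idx n} (hp : p ∈ posIdx r) : p ∉ cartanIdx n := by
  obtain ⟨i, m⟩ := p
  simp only [posIdx, cartanIdx, Set.mem_ofPred_eq] at hp ⊢
  rintro rfl
  rcases hp with h | ⟨j, hj, h⟩
  · simp at h
  · exact irrefl_of r i (e_injective h ▸ hj)

theorem negIdx_disjoint {p : Idx n} (hp : p ∈ negIdx r) : p ∉ cartanIdx n := by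
  obtain ⟨i, m⟩ := p
  simp only [negIdx, cartanIdx, Set.mem_ofPred_eq] at hp ⊢
  rintro rfl
  rcases hp with ⟨j, hj, h⟩ | h
  · exact irrefl_of r i (e_injective h ▸ hj)
  · rw [degree_e] at h; omega

/-- The Cartan subalgebra `𝔥`, spanned by the elements `x_i ∂/∂x_i`. -/
abbrev torus (n : ℕ) : LieSubalgebra ℂ (Witt n) := spanD (cartanIdx n) closed_cartanIdx

/-- The finite-dimensional subalgebra `𝔫₊`. -/
abbrev nPos : LieSubalgebra ℂ (Witt n) := spanD (posIdx r) (closed_posIdx r)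

/-- The subalgebra `𝔫₋`. -/
abbrev nNeg : LieSubalgebra ℂ (Witt n) := spanD (negIdx r) (closed_negIdx r)

/-- The subalgebra `𝔥 ⊕ 𝔫₊`. -/
abbrev bPos : LieSubalgebra ℂ (Witt n) :=
  spanD (cartanIdx n ∪ posIdx r) (closed_union (closed_posIdx r))

/-- The subalgebra `𝔥 ⊕ 𝔫₋`. -/
abbrev bNeg : LieSubalgebra ℂ (Witt n) :=
  spanD (cartanIdx n ∪ negIdx r) (closed_union (closed_negIdx r))

end Order

theorem D_mem_spanD {S : Set (Idx n)} (hS : IsClosedIdx S) {p : Idx n} (hp : p ∈ S) :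
    D p ∈ spanD S hS :=
  Submodule.subset_span ⟨p, hp, rfl⟩

open Classical in
/-- The linear projection of the Witt algebra onto `𝔥` that kills all `D_i(m)` not in `𝔥`. -/
def torusProj (n : ℕ) : Witt n →ₗ[ℂ] torus n :=
  (wittBasis n).constr ℂ fun p =>
    if h : p ∈ cartanIdx n then ⟨D p, D_mem_spanD closed_cartanIdx h⟩ else 0

theorem torusProj_D_of_notMem {p : Idx n} (h : p ∉ cartanIdx n) : torusProj n (D p) = 0 := by
  rw [← wittBasis_apply, torusProj, Module.Basis.constr_basis, dif_neg h]

theorem sub_smul_witt (a b : ℂ) (x : Witt n) : (a - b) • x = a • x - b • x := by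
  apply MvPolynomial.derivation_ext
  intro j
  simp only [Derivation.smul_apply, Derivation.sub_apply, sub_smul]

theorem lie_cartan_D {p : Idx n} (hp : p ∈ cartanIdx n) (q : Idx n) :
    ⁅D p, D q⁆ = ((q.2 p.1 : ℂ) - (e p.1 q.1 : ℂ)) • D q := by
  have hp' : p.2 = e p.1 := hp
  have h1 : (q.1, p.2 + q.2 - e p.1) = q := by rw [hp', add_tsub_cancel_left]
  have h2 : (p.2 q.1 : ℂ) • D (p.1, p.2 + q.2 - e q.1) = (e p.1 q.1 : ℂ) • D q := by
    rw [hp']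
    by_cases h : e p.1 q.1 = 0
    · rw [h, Nat.cast_zero, zero_smul, zero_smul]
    · rw [eq_of_e_apply_ne h, add_tsub_cancel_left]
  rw [lie_D, h1, h2, sub_smul_witt]

theorem torusProj_lie {S : Set (Idx n)} (hS : IsClosedIdx S) (hd : ∀ p ∈ S, p ∉ cartanIdx n)
    {x y : Witt n} (hx : x ∈ spanD (cartanIdx n ∪ S) (closed_union hS))
    (hy : y ∈ spanD (cartanIdx n ∪ S) (closed_union hS)) :
    torusProj n ⁅x, y⁆ = 0 := by
  have key : ∀ p ∈ cartanIdx n, ∀ q, torusProj n ⁅D p, D q⁆ = 0 := by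
    intro p hp q
    rw [lie_cartan_D hp, map_smul]
    by_cases hq : q ∈ cartanIdx n
    · have hq' : q.2 = e q.1 := hq
      rw [hq', e_apply, e_apply]
      simp [eq_comm]
    · rw [torusProj_D_of_notMem hq, smul_zero]
  refine lie_mem_of_mem_span (P := LinearMap.ker (torusProj n)) ?_ hx hy
  rintro _ ⟨p, hp, rfl⟩ _ ⟨q, hq, rfl⟩
  change torusProj n ⁅D p, D q⁆ = 0
  rcases hp with hp | hp
  · exact key p hp q
  · rcases hq with hq | hq
    · have h := key q hq p
      rw [← lie_skew] at h
      rw [map_neg, neg_eq_zero] at h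
      exact h
    · have h : ⁅D p, D q⁆ ∈ Submodule.span ℂ (D '' S) :=
        (spanD S hS).lie_mem (D_mem_spanD hS hp) (D_mem_spanD hS hq)
      have h2 : Submodule.span ℂ (D '' S) ≤ LinearMap.ker (torusProj n) := by
        rw [Submodule.span_le]
        rintro _ ⟨p, hp, rfl⟩
        exact torusProj_D_of_notMem (hd p hp)
      exact h2 h

/-- The character of `𝔥 ⊕ 𝔫` that extends `μ ∈ 𝔥*` by zero on `𝔫`, where `𝔫` is the span of the
`D_i(m)` with `(i, m) ∈ S`. -/
def extendChar {S : Set (Idx n)} (hS : IsClosedIdx S) (hd : ∀ p ∈ S, p ∉ cartanIdx n)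
    (μ : Module.Dual ℂ (torus n)) :
    LieAlgebra.LieCharacter ℂ (spanD (cartanIdx n ∪ S) (closed_union hS)) where
  toLinearMap := μ ∘ₗ torusProj n ∘ₗ (spanD (cartanIdx n ∪ S) (closed_union hS)).toSubmodule.subtype
  map_lie' {x y} := by
    have h : torusProj n ⁅(x : Witt n), (y : Witt n)⁆ = 0 := torusProj_lie hS hd x.2 y.2
    have h2 : ∀ a b : ℂ, ⁅a, b⁆ = 0 := fun a b => by
      rw [LieRing.of_associative_ring_bracket, mul_comm, sub_self]
    rw [h2]
    change μ (torusProj n ⁅(x : Witt n), (y : Witt n)⁆) = 0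
    rw [h, map_zero]

/-! ### Highest and lowest weight modules, standard Whittaker modules -/

section Modules

variable (r : Fin n → Fin n → Prop) [IsStrictTotalOrder (Fin n) r]

/-- The highest weight Verma module `M⁺(μ) = U(𝔴ₙ) ⊗_{U(𝔥 ⊕ 𝔫₊)} ℂ_μ`. -/
abbrev MPos (μ : Module.Dual ℂ (torus n)) : Type :=
  Ind (bPos r) (CharModule (extendChar (closed_posIdx r) (fun _ => posIdx_disjoint r) μ))

/-- The lowest weight Verma module `M⁻(μ) = U(𝔴ₙ) ⊗_{U(𝔥 ⊕ 𝔫₋)} ℂ_μ`. -/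
abbrev MNeg (μ : Module.Dual ℂ (torus n)) : Type :=
  Ind (bNeg r) (CharModule (extendChar (closed_negIdx r) (fun _ => negIdx_disjoint r) μ))

/-- The simple highest weight module `L⁺(μ)`: the quotient of `M⁺(μ)` by the sum of all its proper
submodules. -/
abbrev LPos (μ : Module.Dual ℂ (torus n)) : Type :=
  MPos r μ ⧸ sSup {N : LieSubmodule ℂ (Witt n) (MPos r μ) | N ≠ ⊤}

/-- The standard Whittaker module `M_χ = U(𝔴ₙ) ⊗_{U(𝔫₊)} ℂ_χ`. -/
abbrev MStd (χ : LieAlgebra.LieCharacter ℂ (nPos r)) : Type :=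
  Ind (nPos r) (CharModule χ)

end Modules

/-! ### Completions -/

/-- The linear form on `𝔥` that reads off the coefficient at `x_k ∂/∂x_k`. -/
def torusCoord (k : Fin n) : Module.Dual ℂ (torus n) :=
  (wittBasis n).coord (k, e k) ∘ₗ (torus n).toSubmodule.subtype

/-- The weight `m - e_i ∈ 𝔥*` of the element `D_i(m)`. -/
def wt (p : Idx n) : Module.Dual ℂ (torus n) :=
  (∑ k, (p.2 k : ℂ) • torusCoord k) - torusCoord p.1

theorem lie_torus_D (h : torus n) (p : Idx n) : ⁅(h : Witt n), D p⁆ = wt p h • D p := by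
  obtain ⟨h, hh⟩ := h
  have hh' : h ∈ Submodule.span ℂ (D '' cartanIdx n) := hh
  induction hh' using Submodule.span_induction with
  | mem x hx =>
    obtain ⟨q, hq, rfl⟩ := hx
    obtain ⟨i, m⟩ := q
    have hm : m = e i := hq
    subst hm
    change ⁅D (i, e i), D p⁆ = _
    rw [lie_cartan_D hq]
    congr 1
    have hc : ∀ k, torusCoord k ⟨D (i, e i), hh⟩ = (e i k : ℂ) := by
      intro k
      change (wittBasis n).coord (k, e k) (D (i, e i)) = _
      rw [← wittBasis_apply, Module.Basis.coord_apply, Module.Basis.repr_self, e_apply,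
        Finsupp.single_apply]
      by_cases hik : i = k
      · subst hik; simp
      · simp [hik]
    rw [wt, LinearMap.sub_apply, hc, LinearMap.sum_apply]
    simp only [LinearMap.smul_apply, hc, smul_eq_mul, e_apply]
    simp
  | zero =>
    change ⁅(0 : Witt n), D p⁆ = wt p 0 • D p
    rw [map_zero, zero_smul]
    exact zero_lie (D p)
  | add x y hx hy h1 h2 =>
    have h1' := h1 hx
    have h2' := h2 hy
    change ⁅x + y, D p⁆ = wt p (⟨x, hx⟩ + ⟨y, hy⟩) • D p
    rw [map_add, add_smul, ← h1', ← h2']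
    exact add_lie x y (D p)
  | smul t x hx h1 =>
    have h1' := h1 hx
    change ⁅t • x, D p⁆ = wt p (t • ⟨x, hx⟩) • D p
    rw [map_smul, smul_assoc, ← h1']
    exact smul_lie t x (D p)

theorem wt_add {p q : Idx n} (h : q.2 p.1 ≠ 0) : wt (q.1, p.2 + q.2 - e p.1) = wt p + wt q := by
  obtain ⟨i, m⟩ := p
  obtain ⟨j, k⟩ := q
  obtain ⟨k, rfl⟩ : ∃ k', k = e i + k' := eq_e_add h
  simp only [wt, add_e_add_sub]
  have he : ∑ l, ((e i l : ℕ) : ℂ) • torusCoord l = torusCoord i := by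
    simp only [e_apply]
    simp
  simp only [Finsupp.add_apply, Nat.cast_add, add_smul, Finset.sum_add_distrib, he]
  abel

section Completion

variable (M : Type) [AddCommGroup M] [Module ℂ M] [LieRingModule (Witt n) M]
  [LieModule ℂ (Witt n) M]

/-- The weight space `M_ν`. -/
def wtSpace (ν : Module.Dual ℂ (torus n)) : Submodule ℂ M where
  carrier := {v | ∀ h : torus n, ⁅(h : Witt n), v⁆ = ν h • v}
  add_mem' {v w} hv hw h := by rw [lie_add, hv h, hw h, smul_add]
  zero_mem' h := by rw [lie_zero, smul_zero]
  smul_mem' t v hv h := by rw [lie_smul, hv h, smul_comm]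

variable {M} in
theorem lie_D_mem {p : Idx n} {ν κ : Module.Dual ℂ (torus n)} (hκ : ν + wt p = κ) {v : M}
    (hv : v ∈ wtSpace M ν) : ⁅D p, v⁆ ∈ wtSpace M κ := by
  intro h
  subst hκ
  have hv' : ⁅(h : Witt n), v⁆ = ν h • v := hv h
  have hD : ⁅(h : Witt n), D p⁆ = wt p h • D p := lie_torus_D h p
  rw [leibniz_lie, hv', lie_smul, LinearMap.add_apply, add_smul, add_comm]
  congr 1
  rw [← smul_lie, ← hD]

variable (n)

/-- The completion `∏_ν M_ν` of a weight module `M = ⨁_ν M_ν`. -/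
def Completion : Type := (ν : Module.Dual ℂ (torus n)) → wtSpace M ν

namespace Completion

instance : AddCommGroup (Completion n M) :=
  inferInstanceAs (AddCommGroup ((ν : Module.Dual ℂ (torus n)) → wtSpace M ν))

instance : Module ℂ (Completion n M) :=
  inferInstanceAs (Module ℂ ((ν : Module.Dual ℂ (torus n)) → wtSpace M ν))

variable {n M} in
/-- The component of weight `κ`, viewed in `M`. -/
def comp (f : Completion n M) (κ : Module.Dual ℂ (torus n)) : M := (f κ : M)

variable {n M} in
theorem ext_comp {f f' : Completion n M} (h : ∀ κ, f.comp κ = f'.comp κ) : f = f' :=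
  funext fun κ => Subtype.ext (h κ)

variable {n M} in
theorem comp_sub (f f' : Completion n M) (κ : Module.Dual ℂ (torus n)) :
    (f - f').comp κ = f.comp κ - f'.comp κ := rfl

variable {n M} in
theorem comp_smul (t : ℂ) (f : Completion n M) (κ : Module.Dual ℂ (torus n)) :
    (t • f).comp κ = t • f.comp κ := rfl

variable {n} in
/-- The componentwise action of `D_i(m)`: it maps the component of weight `ν` to the component of
weight `ν + wt (i, m)`. -/
def actD (p : Idx n) : Module.End ℂ (Completion n M) where
  toFun f κ := ⟨⁅D p, f.comp (κ - wt p)⁆, lie_D_mem (sub_add_cancel κ (wt p)) (f (κ - wt p)).2⟩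
  map_add' f f' := ext_comp fun κ => lie_add (D p) (f.comp (κ - wt p)) (f'.comp (κ - wt p))
  map_smul' t f := ext_comp fun κ => lie_smul t (D p) (f.comp (κ - wt p))

variable {n M} in
theorem comp_actD (p : Idx n) (f : Completion n M) (κ : Module.Dual ℂ (torus n)) :
    (actD M p f).comp κ = ⁅D p, f.comp (κ - wt p)⁆ := rfl

/-- The action of the Witt algebra: the linear extension of the action of the `D_i(m)`. -/
def act : Witt n →ₗ[ℂ] Module.End ℂ (Completion n M) := (wittBasis n).constr ℂ (actD M)

variable {n} in
theorem act_D (p : Idx n) : act n M (D p) = actD M p := by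
  rw [← wittBasis_apply, act, Module.Basis.constr_basis]

variable {n} in
theorem act_lie_D (p q : Idx n) :
    act n M ⁅D p, D q⁆ = actD M p * actD M q - actD M q * actD M p := by
  have aux : ∀ (p q : Idx n) (f : Completion n M) (κ : Module.Dual ℂ (torus n)),
      (q.2 p.1 : ℂ) • (actD M (q.1, p.2 + q.2 - e p.1) f).comp κ =
        ⁅(q.2 p.1 : ℂ) • D (q.1, p.2 + q.2 - e p.1), f.comp (κ - wt p - wt q)⁆ := by
    intro p q f κ
    by_cases h : q.2 p.1 = 0
    · rw [h, Nat.cast_zero, zero_smul, zero_smul, zero_lie]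
    · rw [sub_sub, ← wt_add h, comp_actD]
      exact (smul_lie (q.2 p.1 : ℂ) (D (q.1, p.2 + q.2 - e p.1)) _).symm
  refine LinearMap.ext fun f => ext_comp fun κ => ?_
  rw [lie_D, map_sub, map_smul, map_smul, act_D, act_D, LinearMap.sub_apply, LinearMap.sub_apply,
    LinearMap.smul_apply, LinearMap.smul_apply, Module.End.mul_apply, Module.End.mul_apply,
    comp_sub, comp_sub, comp_smul, comp_smul, comp_actD p, comp_actD q, comp_actD q, comp_actD p,
    aux p q f κ, add_comm p.2, aux q p f κ, sub_right_comm κ (wt q), ← lie_lie, ← sub_lie,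
    add_comm q.2]
  have h := lie_D p q
  rw [← h]

theorem act_lie (x y : Witt n) :
    act n M ⁅x, y⁆ = act n M x * act n M y - act n M y * act n M x := by
  have hx : x ∈ Submodule.span ℂ (Set.range (wittBasis n)) := (wittBasis n).mem_span x
  have hy : y ∈ Submodule.span ℂ (Set.range (wittBasis n)) := (wittBasis n).mem_span y
  induction hx, hy using Submodule.span_induction₂ with
  | mem_mem x y hx hy =>
    obtain ⟨p, rfl⟩ := hx
    obtain ⟨q, rfl⟩ := hy
    rw [wittBasis_apply, wittBasis_apply, act_D, act_D]
    exact act_lie_D M p q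
  | zero_left y hy =>
    have h : ⁅(0 : Witt n), y⁆ = 0 := zero_lie y
    rw [h, map_zero, zero_mul, mul_zero, sub_zero]
  | zero_right x hx =>
    have h : ⁅x, (0 : Witt n)⁆ = 0 := lie_zero x
    rw [h, map_zero, zero_mul, mul_zero, sub_zero]
  | add_left x y z _ _ _ h1 h2 =>
    have h : ⁅x + y, z⁆ = ⁅x, z⁆ + ⁅y, z⁆ := add_lie x y z
    rw [h, map_add, h1, h2, map_add, add_mul, mul_add]
    abel
  | add_right x y z _ _ _ h1 h2 =>
    have h : ⁅x, y + z⁆ = ⁅x, y⁆ + ⁅x, z⁆ := lie_add x y z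
    rw [h, map_add, h1, h2, map_add, add_mul, mul_add]
    abel
  | smul_left t x y _ _ h1 =>
    have h : ⁅t • x, y⁆ = t • ⁅x, y⁆ := smul_lie t x y
    rw [h, map_smul, h1, map_smul, smul_sub, smul_mul_assoc, mul_smul_comm]
  | smul_right t x y _ _ h1 =>
    have h : ⁅x, t • y⁆ = t • ⁅x, y⁆ := lie_smul t x y
    rw [h, map_smul, h1, map_smul, smul_sub, smul_mul_assoc, mul_smul_comm]

instance : LieRingModule (Witt n) (Completion n M) where
  bracket x f := act n M x f
  add_lie x y f := by rw [map_add, LinearMap.add_apply]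
  lie_add x f f' := map_add (act n M x) f f'
  leibniz_lie x y f := by
    rw [act_lie, LinearMap.sub_apply, Module.End.mul_apply, Module.End.mul_apply, sub_add_cancel]

theorem lie_def (x : Witt n) (f : Completion n M) : ⁅x, f⁆ = act n M x f := rfl

instance : LieModule ℂ (Witt n) (Completion n M) where
  smul_lie t x f := by rw [lie_def, lie_def, map_smul, LinearMap.smul_apply]
  lie_smul t x f := map_smul (act n M x) t f

end Completion

end Completion

end WittWhittaker

end

/-!
Since `M⁻(-μ)` is simple, the invariant pairing of `L⁺(μ)` with `M⁻(-μ)` has no kernel on either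
side. The weight spaces of `M⁻(-μ)` are finite-dimensional, because there are only finitely many
words in the finitely many generators of `𝔫₊` of a given degree; so the pairing is perfect on each
weight space, and the completion of `L⁺(μ)` is the full dual of `M⁻(-μ)`.

As `𝔴 = 𝔫₊ ⊕ (𝔥 ⊕ 𝔫₋)`, the module `M⁻(-μ)` is free of rank one over `U(𝔫₊)`. A Whittaker vector of
type `λ` in its dual is a linear form that is determined by its value on the generator, and such a
form exists for every `λ`. Frobenius reciprocity then gives the homomorphism from `M_λ`.

For the simplicity of the image, order the elements `D_i(m)` by degree. For `x ∈ 𝔫₊`, the operator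
`x - λ(x)` lowers the resulting filtration of the image, so every nonzero submodule contains a
nonzero Whittaker vector, and this is a multiple of the generator. Finally, a nonzero submodule of
the dual of a simple module separates points, so it has the same annihilator as the whole dual.
-/

noncomputable section

open scoped TensorProduct

attribute [local instance 100] LieRing.ofAssociativeRing

namespace WittWhittaker

section Enveloping

variable {R L : Type*} [CommRing R] [LieRing L] [LieAlgebra R L]

@[elab_as_elim]
theorem uea_induction {motive : UniversalEnvelopingAlgebra R L → Prop}
    (u : UniversalEnvelopingAlgebra R L) (one : motive 1)
    (add : ∀ u v, motive u → motive v → motive (u + v))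
    (smul : ∀ (c : R) u, motive u → motive (c • u))
    (ι_mul : ∀ x u, motive u → motive (UniversalEnvelopingAlgebra.ι R x * u)) : motive u := by
  suffices h : ∀ v, motive v → motive (u * v) by simpa using h 1 one
  obtain ⟨t, rfl⟩ : ∃ t, UniversalEnvelopingAlgebra.mkAlgHom R L t = u :=
    Quotient.exists_rep u
  induction t using TensorAlgebra.induction with
  | algebraMap c =>
    intro v hv
    rw [AlgHom.commutes, ← Algebra.smul_def]
    exact smul c v hv
  | ι x => exact ι_mul x
  | mul s t hs ht =>
    intro v hv
    rw [map_mul, mul_assoc]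
    exact hs _ (ht v hv)
  | add s t hs ht =>
    intro v hv
    rw [map_add, add_mul]
    exact add _ _ (hs v hv) (ht v hv)

end Enveloping

section General

variable {g : Type} [LieRing g] [LieAlgebra ℂ g]
  {M N : Type} [AddCommGroup M] [Module ℂ M] [LieRingModule g M] [LieModule ℂ g M]
  [AddCommGroup N] [Module ℂ N] [LieRingModule g N] [LieModule ℂ g N]

variable (g M) in
/-- The action `U(g) → End_ℂ M` of the enveloping algebra on a `g`-module; its kernel is
`annihilator g M`. -/
abbrev actU : U g →ₐ[ℂ] Module.End ℂ M :=
  UniversalEnvelopingAlgebra.lift ℂ (LieModule.toEnd ℂ g M)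

theorem actU_toU (x : g) (m : M) : actU g M (toU x) m = ⁅x, m⁆ := by
  rw [actU, toU, UniversalEnvelopingAlgebra.lift_ι_apply, LieModule.toEnd_apply_apply]

theorem map_actU (f : M →ₗ⁅ℂ,g⁆ N) (u : U g) (m : M) : f (actU g M u m) = actU g N u (f m) := by
  induction u using uea_induction with
  | one => simp only [map_one, Module.End.one_apply]
  | add u v hu hv => simp only [map_add, LinearMap.add_apply, hu, hv]
  | smul c u hu => simp only [map_smul, LinearMap.smul_apply, hu]
  | ι_mul x u hu =>
    simp only [map_mul, Module.End.mul_apply, actU_toU, LieModuleHom.map_lie, hu]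

theorem mem_annihilator {u : U g} : u ∈ annihilator g M ↔ ∀ m : M, actU g M u m = 0 := by
  rw [annihilator, RingHom.mem_ker, LinearMap.ext_iff]
  rfl

section Whittaker

variable {a : LieSubalgebra ℂ g} {χ : LieAlgebra.LieCharacter ℂ a}

theorem mem_whittaker {m : M} : m ∈ whittaker χ M ↔ ∀ x : a, ⁅(x : g), m⁆ = χ x • m := Iff.rfl

theorem map_mem_whittaker (f : M →ₗ⁅ℂ,g⁆ N) {m : M} (hm : m ∈ whittaker χ M) :
    f m ∈ whittaker χ N := fun x ↦ by
  rw [LieSubalgebra.coe_bracket_of_module, ← LieModuleHom.map_lie, mem_whittaker.1 hm, map_smul]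

variable (χ) in
/-- The map between the spaces of Whittaker vectors given by a homomorphism of modules. -/
def whittakerMap (f : M →ₗ⁅ℂ,g⁆ N) : whittaker χ M →ₗ[ℂ] whittaker χ N :=
  (f : M →ₗ[ℂ] N).restrict fun _ ↦ map_mem_whittaker f

theorem whittakerMap_injective {f : M →ₗ⁅ℂ,g⁆ N} (hf : Function.Injective f) :
    Function.Injective (whittakerMap χ f) :=
  fun _ _ h ↦ Subtype.ext (hf (congrArg Subtype.val h))

variable (χ) in
theorem finrank_whittaker_congr (f : M ≃ₗ⁅ℂ,g⁆ N) :
    Module.finrank ℂ (whittaker χ M) = Module.finrank ℂ (whittaker χ N) :=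
  (LinearEquiv.ofBijective (whittakerMap χ f.toLieModuleHom)
    ⟨whittakerMap_injective f.injective, fun n ↦
      ⟨⟨f.symm n, map_mem_whittaker f.symm.toLieModuleHom n.2⟩,
        Subtype.ext (f.apply_symm_apply n)⟩⟩).finrank_eq

end Whittaker

namespace Ind

variable {b : LieSubalgebra ℂ g} (χ : LieAlgebra.LieCharacter ℂ b)

/-- The canonical generator `1 ⊗ 1` of a module induced from a character. -/
def gen : Ind b (CharModule χ) := (indRel b (CharModule χ)).mkQ (1 ⊗ₜ[ℂ] (1 : ℂ))

theorem mkQ_tmul (u : U g) (c : ℂ) :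
    (indRel b (CharModule χ)).mkQ (u ⊗ₜ[ℂ] c) = c • u • gen χ := by
  have h : (u ⊗ₜ[ℂ] c : U g ⊗[ℂ] CharModule χ) = c • u • ((1 : U g) ⊗ₜ[ℂ] (1 : ℂ)) := by
    rw [TensorProduct.smul_tmul', smul_eq_mul, mul_one, ← TensorProduct.tmul_smul]
    congr 1
    exact (mul_one c).symm
  rw [h]
  rfl

theorem gen_mem_whittaker : gen χ ∈ whittaker χ (Ind b (CharModule χ)) := by
  refine mem_whittaker.2 fun x ↦ ?_
  have hrel : (indRel b (CharModule χ)).mkQ ((1 * toU (x : g)) ⊗ₜ[ℂ] (1 : ℂ)) =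
      (indRel b (CharModule χ)).mkQ (1 ⊗ₜ[ℂ] (χ x • (1 : ℂ))) :=
    (Submodule.Quotient.eq _).2 (Submodule.subset_span ⟨1, x, (1 : ℂ), rfl⟩)
  rwa [mkQ_tmul, mkQ_tmul, one_smul, one_mul, one_smul, smul_eq_mul, mul_one] at hrel

variable {χ} in
theorem eq_top_of_gen_mem {p : Submodule ℂ (Ind b (CharModule χ))} (hgen : gen χ ∈ p)
    (hp : ∀ (x : g), ∀ m ∈ p, ⁅x, m⁆ ∈ p) : p = ⊤ := by
  have smul_gen (u : U g) : u • gen χ ∈ p := by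
    induction u using uea_induction with
    | one => rwa [one_smul]
    | add u v hu hv => rw [add_smul]; exact p.add_mem hu hv
    | smul c u hu => rw [smul_assoc]; exact p.smul_mem c hu
    | ι_mul x u hu => rw [mul_smul]; exact hp x _ hu
  refine Submodule.eq_top_iff'.2 fun m ↦ ?_
  obtain ⟨t, rfl⟩ := (indRel b (CharModule χ)).mkQ_surjective m
  induction t using TensorProduct.induction_on with
  | zero => rw [map_zero]; exact p.zero_mem
  | tmul u c => exact mkQ_tmul χ u c ▸ p.smul_mem c (smul_gen u)
  | add s t hs ht => rw [map_add]; exact p.add_mem hs ht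

variable {χ} in
theorem lieSpan_gen_eq_top_of_sup_eq_top {a : LieSubalgebra ℂ g}
    (hab : a.toSubmodule ⊔ b.toSubmodule = ⊤) :
    LieSubmodule.lieSpan ℂ a {gen χ} = ⊤ := by
  set P := LieSubmodule.lieSpan ℂ a {gen χ}
  have hgen : gen χ ∈ P := LieSubmodule.subset_lieSpan rfl
  have hstable (y : g) (m) (hm : m ∈ P) : ⁅y, m⁆ ∈ P := by
    induction hm using LieSubmodule.lieSpan_induction generalizing y with
    | mem m hm =>
      obtain rfl := Set.mem_singleton_iff.1 hm
      obtain ⟨x, hx, z, hz, rfl⟩ := Submodule.mem_sup.1 (hab.ge (Submodule.mem_top (x := y)))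
      rw [add_lie, mem_whittaker.1 (gen_mem_whittaker χ) ⟨z, hz⟩]
      exact P.add_mem (P.lie_mem (x := (⟨x, hx⟩ : a)) hgen) (P.smul_mem _ hgen)
    | zero => rw [lie_zero]; exact P.zero_mem
    | add m m' _ _ h h' => rw [lie_add]; exact P.add_mem (h y) (h' y)
    | smul c m _ h => rw [lie_smul]; exact P.smul_mem c (h y)
    | lie x m _ h =>
      rw [LieSubalgebra.coe_bracket_of_module, leibniz_lie]
      exact P.add_mem (h _) (P.lie_mem (x := x) (h y))
  exact P.toSubmodule_eq_top.1 (eq_top_of_gen_mem hgen hstable)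

theorem lieSpan_gen_eq_top : LieSubmodule.lieSpan ℂ g {gen χ} = ⊤ :=
  (LieSubmodule.toSubmodule_eq_top _).1 <| eq_top_of_gen_mem (LieSubmodule.subset_lieSpan rfl)
    fun _ _ hm ↦ LieSubmodule.lie_mem _ hm

variable {χ} in
theorem hom_ext {P : Type} [AddCommGroup P] [Module ℂ P] [LieRingModule g P]
    {f f' : Ind b (CharModule χ) →ₗ⁅ℂ,g⁆ P} (h : f (gen χ) = f' (gen χ)) :
    f = f' := by
  have htop : LinearMap.eqLocus (f : Ind b (CharModule χ) →ₗ[ℂ] P) f' = ⊤ :=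
    eq_top_of_gen_mem h fun x m (hm : f m = f' m) ↦
      show f ⁅x, m⁆ = f' ⁅x, m⁆ by rw [LieModuleHom.map_lie, LieModuleHom.map_lie, hm]
  exact LieModuleHom.ext fun m ↦ htop.ge (Submodule.mem_top (x := m))

/-- The homomorphism from an induced module given by a Whittaker vector. -/
def lift (v : whittaker χ M) : Ind b (CharModule χ) →ₗ⁅ℂ,g⁆ M :=
  letI : Module (U g) M := Module.compHom M (actU g M).toRingHom
  haveI : IsScalarTower ℂ (U g) M := ⟨fun c u m ↦ LinearMap.congr_fun (map_smul (actU g M) c u) m⟩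
  let F : U g ⊗[ℂ] CharModule χ →ₗ[U g] M := TensorProduct.AlgebraTensorModule.lift <|
    LinearMap.toSpanSingleton (U g) (CharModule χ →ₗ[ℂ] M) (LinearMap.toSpanSingleton ℂ M v)
  let f : Ind b (CharModule χ) →ₗ[U g] M := (indRel b (CharModule χ)).liftQ F <| by
    refine Submodule.span_le.2 ?_
    rintro _ ⟨u, x, (c : ℂ), rfl⟩
    have hv : toU (x : g) • (v : M) = χ x • (v : M) :=
      (actU_toU _ _).trans (mem_whittaker.1 v.2 x)
    rw [SetLike.mem_coe, LinearMap.mem_ker, map_sub, sub_eq_zero]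
    change (u * toU (x : g)) • c • (v : M) = u • (χ x * c) • (v : M)
    rw [mul_smul, smul_comm _ c, hv, mul_comm, mul_smul]
  { f.restrictScalars ℂ with
    map_lie' := fun {x m} ↦ (f.map_smul (toU x) m).trans (actU_toU x (f m)) }

theorem lift_gen (v : whittaker χ M) : lift χ v (gen χ) = v := by
  change actU g M 1 ((1 : ℂ) • (v : M)) = v
  rw [map_one, one_smul, Module.End.one_apply]

/-- Frobenius reciprocity for modules induced from a character. -/
def homEquiv : (Ind b (CharModule χ) →ₗ⁅ℂ,g⁆ M) ≃ₗ[ℂ] whittaker χ M where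
  toFun f := ⟨f (gen χ), map_mem_whittaker f (gen_mem_whittaker χ)⟩
  map_add' _ _ := rfl
  map_smul' _ _ := rfl
  invFun := lift χ
  left_inv _ := hom_ext (lift_gen χ _)
  right_inv v := Subtype.ext (lift_gen χ v)

end Ind

end General

section SplitAction

variable {R g : Type*} [CommRing R] [LieRing g] [LieAlgebra R g]

/-- Left multiplication makes the enveloping algebra of a Lie algebra a module over it. -/
instance (L : Type*) [LieRing L] [LieAlgebra R L] :
    LieRingModule L (UniversalEnvelopingAlgebra R L) where
  bracket x t := UniversalEnvelopingAlgebra.ι R x * t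
  add_lie x y t := by rw [map_add, add_mul]
  lie_add _ _ _ := mul_add _ _ _
  leibniz_lie x y t := by
    rw [LieHom.map_lie, LieRing.of_associative_ring_bracket, sub_mul, mul_assoc, mul_assoc,
      sub_add_cancel]

theorem lie_uea {L : Type*} [LieRing L] [LieAlgebra R L] (x : L)
    (t : UniversalEnvelopingAlgebra R L) : ⁅x, t⁆ = UniversalEnvelopingAlgebra.ι R x * t :=
  rfl

instance (L : Type*) [LieRing L] [LieAlgebra R L] :
    LieModule R L (UniversalEnvelopingAlgebra R L) where
  smul_lie c x t := by rw [lie_uea, lie_uea, map_smul, smul_mul_assoc]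
  lie_smul c x t := by rw [lie_uea, lie_uea, mul_smul_comm]

variable {a b : LieSubalgebra R g} (hab : IsCompl a.toSubmodule b.toSubmodule)
  (β : LieAlgebra.LieCharacter R b)

/-- For `g = a ⊕ b` and a character `β` of `b`, the action `g → End U(a)` on the module induced
from `β`, which is free over `U(a)` on one generator. It is determined by the action on `1`, since
`y (x t) = x (y t) - [x, y] t` for `x ∈ a` says that `t ↦ (y ↦ y t)` is a homomorphism of
`a`-modules from `U(a)` to the space of linear maps `g → U(a)`. -/
def splitAction : g →ₗ[R] Module.End R (UniversalEnvelopingAlgebra R a) :=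
  LinearMap.flip <|
    LinearMap.applyₗ (LinearMap.ofIsCompl hab
      (UniversalEnvelopingAlgebra.ι R : a →ₗ⁅R⁆ UniversalEnvelopingAlgebra R a).toLinearMap
      (LinearMap.toSpanSingleton R _ 1 ∘ₗ (β : b →ₗ[R] R))) ∘ₗ
    (UniversalEnvelopingAlgebra.lift R
      (LieModule.toEnd R a (g →ₗ[R] UniversalEnvelopingAlgebra R a))).toLinearMap

theorem splitAction_ι_mul (y : g) (x : a) (t : UniversalEnvelopingAlgebra R a) :
    splitAction hab β y (UniversalEnvelopingAlgebra.ι R x * t) =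
      UniversalEnvelopingAlgebra.ι R x * splitAction hab β y t
        - splitAction hab β ⁅(x : g), y⁆ t := by
  simp only [splitAction, LinearMap.flip_apply, LinearMap.comp_apply, AlgHom.toLinearMap_apply,
    map_mul, UniversalEnvelopingAlgebra.lift_ι_apply]
  rfl

theorem splitAction_left_one (x : a) :
    splitAction hab β x 1 = UniversalEnvelopingAlgebra.ι R x := by
  rw [splitAction, LinearMap.flip_apply, LinearMap.comp_apply, AlgHom.toLinearMap_apply, map_one]
  exact LinearMap.ofIsCompl_apply_left hab x

theorem splitAction_right_one (y : b) : splitAction hab β y 1 = β y • 1 := by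
  rw [splitAction, LinearMap.flip_apply, LinearMap.comp_apply, AlgHom.toLinearMap_apply, map_one]
  exact LinearMap.ofIsCompl_apply_right hab y

theorem splitAction_left (x : a) (t : UniversalEnvelopingAlgebra R a) :
    splitAction hab β x t = UniversalEnvelopingAlgebra.ι R x * t := by
  induction t using uea_induction generalizing x with
  | one => rw [splitAction_left_one, mul_one]
  | add t t' h h' => rw [map_add, h, h', mul_add]
  | smul c t h => rw [map_smul, h, mul_smul_comm]
  | ι_mul x' t h =>
    rw [splitAction_ι_mul, h, ← LieSubalgebra.coe_bracket, h, LieHom.map_lie,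
      LieRing.of_associative_ring_bracket, sub_mul, mul_assoc, mul_assoc, sub_sub_cancel]

theorem splitAction_lie_left (x : a) (z : g) (t : UniversalEnvelopingAlgebra R a) :
    splitAction hab β ⁅(x : g), z⁆ t =
      ⁅splitAction hab β x, splitAction hab β z⁆ t := by
  rw [LieRing.of_associative_ring_bracket, LinearMap.sub_apply, Module.End.mul_apply,
    Module.End.mul_apply, splitAction_left, splitAction_left, splitAction_ι_mul, sub_sub_cancel]

theorem splitAction_lie_right_one (y z : b) :
    splitAction hab β ⁅(y : g), (z : g)⁆ 1 = ⁅splitAction hab β y, splitAction hab β z⁆ 1 := by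
  rw [← LieSubalgebra.coe_bracket, splitAction_right_one, LieAlgebra.lieCharacter_apply_lie,
    zero_smul, LieRing.of_associative_ring_bracket, LinearMap.sub_apply, Module.End.mul_apply,
    Module.End.mul_apply, splitAction_right_one, splitAction_right_one, map_smul, map_smul,
    splitAction_right_one, splitAction_right_one, smul_comm, sub_self]

theorem splitAction_lie_one (y z : g) :
    splitAction hab β ⁅y, z⁆ 1 = ⁅splitAction hab β y, splitAction hab β z⁆ 1 := by
  have hdecomp (y : g) : ∃ (x : a) (y' : b), (x : g) + y' = y := by
    obtain ⟨x, hx, y', hy', h⟩ := Submodule.mem_sup.1 (hab.sup_eq_top.ge (trivial : y ∈ ⊤))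
    exact ⟨⟨x, hx⟩, ⟨y', hy'⟩, h⟩
  obtain ⟨x, y, rfl⟩ := hdecomp y
  obtain ⟨x', z, rfl⟩ := hdecomp z
  have hyx' : splitAction hab β ⁅(y : g), (x' : g)⁆ 1 =
      ⁅splitAction hab β y, splitAction hab β x'⁆ 1 := by
    rw [← lie_skew, map_neg, LinearMap.neg_apply, splitAction_lie_left, ← LinearMap.neg_apply,
      lie_skew]
  simp only [add_lie, lie_add, map_add, LinearMap.add_apply, splitAction_lie_left, hyx',
    splitAction_lie_right_one]

theorem splitAction_lie (y z : g) :
    splitAction hab β ⁅y, z⁆ = ⁅splitAction hab β y, splitAction hab β z⁆ := by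
  refine LinearMap.ext fun t ↦ ?_
  induction t using uea_induction generalizing y z with
  | one => exact splitAction_lie_one hab β y z
  | add t t' h h' => rw [map_add, map_add, h, h']
  | smul c t h => rw [map_smul, map_smul, h]
  | ι_mul x t h =>
    simp only [LieRing.of_associative_ring_bracket, LinearMap.sub_apply, Module.End.mul_apply]
      at h ⊢
    simp only [splitAction_ι_mul, leibniz_lie (x : g) y z, map_add, map_sub, LinearMap.add_apply, h,
      mul_sub]
    abel

/-- The action `splitAction` as a representation. -/
def splitRep : g →ₗ⁅R⁆ Module.End R (UniversalEnvelopingAlgebra R a) :=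
  { splitAction hab β with map_lie' := fun {y z} ↦ splitAction_lie hab β y z }

end SplitAction

section DualWhittaker

/-- The character `-χ`. -/
def negChar {R L : Type*} [CommRing R] [LieRing L] [LieAlgebra R L]
    (χ : LieAlgebra.LieCharacter R L) : LieAlgebra.LieCharacter R L where
  toLinearMap := -(χ : L →ₗ[R] R)
  map_lie' {x y} := by
    change -χ ⁅x, y⁆ = ⁅-χ x, -χ y⁆
    rw [LieAlgebra.lieCharacter_apply_lie, neg_zero, LieRing.of_associative_ring_bracket, mul_comm,
      sub_self]

variable {g : Type} [LieRing g] [LieAlgebra ℂ g] {a b : LieSubalgebra ℂ g}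

theorem mem_whittaker_dual {M : Type} [AddCommGroup M] [Module ℂ M] [LieRingModule g M]
    [LieModule ℂ g M] {χ : LieAlgebra.LieCharacter ℂ a} {F : Module.Dual ℂ M} :
    F ∈ whittaker χ (Module.Dual ℂ M) ↔ ∀ (x : a) (m : M), F ⁅(x : g), m⁆ = -(χ x * F m) := by
  simp only [mem_whittaker, LinearMap.ext_iff, Module.Dual.lie_apply, LinearMap.smul_apply,
    smul_eq_mul, neg_eq_iff_eq_neg]

theorem exists_mem_whittaker_dual_gen_eq_one (hab : IsCompl a.toSubmodule b.toSubmodule)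
    (β : LieAlgebra.LieCharacter ℂ b) (χ : LieAlgebra.LieCharacter ℂ a) :
    ∃ F ∈ whittaker χ (Module.Dual ℂ (Ind b (CharModule β))), F (Ind.gen β) = 1 := by
  let _ : LieRingModule g (U a) := LieRingModule.compLieHom (U a) (splitRep hab β)
  have _ : LieModule ℂ g (U a) := LieModule.compLieHom (U a) (splitRep hab β)
  let f : Ind b (CharModule β) →ₗ⁅ℂ,g⁆ U a := Ind.lift β ⟨1, splitAction_right_one hab β⟩
  have hf (x : a) (m) : f ⁅(x : g), m⁆ = toU x * f m :=
    (f.map_lie _ _).trans (splitAction_left hab β x _)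
  let F := (UniversalEnvelopingAlgebra.lift ℂ (negChar χ)).toLinearMap ∘ₗ
    (f : Ind b (CharModule β) →ₗ[ℂ] U a)
  refine ⟨F, mem_whittaker_dual.2 fun x m ↦ ?_, ?_⟩
  · change UniversalEnvelopingAlgebra.lift ℂ (negChar χ) (f ⁅(x : g), m⁆) = _
    rw [hf, map_mul, UniversalEnvelopingAlgebra.lift_ι_apply]
    exact neg_mul _ _
  · change UniversalEnvelopingAlgebra.lift ℂ (negChar χ) (f (Ind.gen β)) = 1
    rw [Ind.lift_gen, map_one]

theorem eq_zero_of_mem_whittaker_dual (hab : a.toSubmodule ⊔ b.toSubmodule = ⊤)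
    {β : LieAlgebra.LieCharacter ℂ b} {χ : LieAlgebra.LieCharacter ℂ a}
    {F : Module.Dual ℂ (Ind b (CharModule β))} (hF : F ∈ whittaker χ (Module.Dual ℂ _))
    (hgen : F (Ind.gen β) = 0) : F = 0 := by
  refine LinearMap.ext fun m ↦ ?_
  have hm : m ∈ LieSubmodule.lieSpan ℂ a {Ind.gen β} :=
    (Ind.lieSpan_gen_eq_top_of_sup_eq_top hab).ge trivial
  rw [LinearMap.zero_apply]
  induction hm using LieSubmodule.lieSpan_induction with
  | mem m hm => rwa [Set.mem_singleton_iff.1 hm]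
  | zero => exact map_zero F
  | add m m' _ _ h h' => rw [map_add, h, h', add_zero]
  | smul c m _ h => rw [map_smul, h, smul_zero]
  | lie x m _ h =>
    rw [LieSubalgebra.coe_bracket_of_module, mem_whittaker_dual.1 hF, h, mul_zero, neg_zero]

theorem finrank_whittaker_dual (hab : IsCompl a.toSubmodule b.toSubmodule)
    (β : LieAlgebra.LieCharacter ℂ b) (χ : LieAlgebra.LieCharacter ℂ a) :
    Module.finrank ℂ (whittaker χ (Module.Dual ℂ (Ind b (CharModule β)))) = 1 := by
  let evalGen : whittaker χ (Module.Dual ℂ (Ind b (CharModule β))) →ₗ[ℂ] ℂ :=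
    LinearMap.applyₗ (Ind.gen β) ∘ₗ (whittaker χ _).toSubmodule.subtype
  obtain ⟨F, hF, hF1⟩ := exists_mem_whittaker_dual_gen_eq_one hab β χ
  have hinj : Function.Injective evalGen := (injective_iff_map_eq_zero evalGen).2 fun F' h ↦
    Subtype.ext (eq_zero_of_mem_whittaker_dual hab.sup_eq_top F'.2 h)
  have hsurj : Function.Surjective evalGen := fun c ↦
    ⟨c • ⟨F, hF⟩, by rw [map_smul]; exact (congrArg (c • ·) hF1).trans (mul_one c)⟩
  rw [(LinearEquiv.ofBijective evalGen ⟨hinj, hsurj⟩).finrank_eq, Module.finrank_self]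

end DualWhittaker

section Duality

variable {g : Type} [LieRing g] [LieAlgebra ℂ g]
  {M N : Type} [AddCommGroup M] [Module ℂ M] [LieRingModule g M] [LieModule ℂ g M]
  [AddCommGroup N] [Module ℂ N] [LieRingModule g N]

variable (M) in
theorem exists_actU_dual_eq_dualMap (u : U g) :
    ∃ T : Module.End ℂ M, actU g (Module.Dual ℂ M) u = T.dualMap := by
  induction u using uea_induction with
  | one => exact ⟨1, by rw [map_one]; rfl⟩
  | add u v hu hv =>
    obtain ⟨S, hS⟩ := hu
    obtain ⟨T, hT⟩ := hv
    refine ⟨S + T, ?_⟩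
    rw [map_add, hS, hT]
    exact (map_add (Module.Dual.transpose (R := ℂ)) S T).symm
  | smul c u hu =>
    obtain ⟨T, hT⟩ := hu
    refine ⟨c • T, ?_⟩
    rw [map_smul, hT]
    exact (map_smul (Module.Dual.transpose (R := ℂ)) c T).symm
  | ι_mul x u hu =>
    obtain ⟨T, hT⟩ := hu
    refine ⟨-(T * LieModule.toEnd ℂ g M x), LinearMap.ext₂ fun F m ↦ ?_⟩
    rw [map_mul, Module.End.mul_apply, actU_toU, hT, Module.Dual.lie_apply]
    exact (map_neg F _).symm

/-- The submodule of the vectors killed by all linear forms in the image of a homomorphism to a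
dual module. -/
def coannihilator (f : N →ₗ⁅ℂ,g⁆ Module.Dual ℂ M) : LieSubmodule ℂ g M where
  toSubmodule := f.range.toSubmodule.dualCoannihilator
  lie_mem {x m} hm := by
    rw [AddSubsemigroup.mem_carrier, AddSubmonoid.mem_toSubsemigroup, Submodule.mem_toAddSubmonoid,
      Submodule.mem_dualCoannihilator] at hm ⊢
    intro F hF
    rw [← neg_eq_zero, ← Module.Dual.lie_apply]
    exact hm _ (f.range.lie_mem hF)

theorem mem_coannihilator {f : N →ₗ⁅ℂ,g⁆ Module.Dual ℂ M} {m : M} :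
    m ∈ coannihilator f ↔ ∀ z, f z m = 0 :=
  (Submodule.mem_dualCoannihilator m).trans
    ⟨fun h z ↦ h _ (f.mem_range_self z), by rintro h _ ⟨z, rfl⟩; exact h z⟩

theorem coannihilator_eq_bot [LieModule.IsIrreducible ℂ g M] {f : N →ₗ⁅ℂ,g⁆ Module.Dual ℂ M}
    (hf : f ≠ 0) : coannihilator f = ⊥ :=
  (eq_bot_or_eq_top _).resolve_right fun h ↦ hf <| LieModuleHom.ext fun z ↦
    LinearMap.ext fun m ↦ mem_coannihilator.1 (h.ge trivial : m ∈ coannihilator f) z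

theorem annihilator_eq_annihilator_dual [LieModule ℂ g N] [LieModule.IsIrreducible ℂ g M]
    {f : N →ₗ⁅ℂ,g⁆ Module.Dual ℂ M} (hf : Function.Injective f) (hf0 : f ≠ 0) :
    annihilator g N = annihilator g (Module.Dual ℂ M) := by
  ext u
  rw [mem_annihilator, mem_annihilator]
  refine ⟨fun hu F ↦ LinearMap.ext fun m ↦ ?_, fun hu z ↦ hf ?_⟩
  · obtain ⟨T, hT⟩ := exists_actU_dual_eq_dualMap M u
    have hTm : T m ∈ coannihilator f := mem_coannihilator.2 fun z ↦ by
      rw [← LinearMap.dualMap_apply, ← hT, ← map_actU, hu, map_zero, LinearMap.zero_apply]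
    rw [coannihilator_eq_bot hf0, LieSubmodule.mem_bot] at hTm
    rw [hT, LinearMap.dualMap_apply, hTm, map_zero, LinearMap.zero_apply]
  · rw [map_actU, hu, map_zero]

end Duality

section Words

variable {R g V ι : Type*} [CommRing R] [LieRing g] [AddCommGroup V] [Module R V]
  [LieRingModule g V]

theorem eq_top_of_mem_of_lieSpan_eq_top {v : V} (hv : LieSubmodule.lieSpan R g {v} = ⊤)
    {N : LieSubmodule R g V} (hvN : v ∈ N) : N = ⊤ :=
  top_le_iff.1 (hv.ge.trans (LieSubmodule.lieSpan_le.2 (Set.singleton_subset_iff.2 hvN)))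

theorem lieSpan_singleton_eq_top_of_surjective {W : Type*} [AddCommGroup W] [Module R W]
    [LieRingModule g W] {f : V →ₗ⁅R,g⁆ W} (hf : Function.Surjective f) {v : V}
    (hv : LieSubmodule.lieSpan R g {v} = ⊤) : LieSubmodule.lieSpan R g {f v} = ⊤ := by
  refine top_le_iff.1 fun w _ ↦ ?_
  obtain ⟨u, rfl⟩ := hf w
  have htop : (LieSubmodule.lieSpan R g {f v}).comap f = ⊤ :=
    eq_top_of_mem_of_lieSpan_eq_top hv (LieSubmodule.subset_lieSpan rfl)
  exact htop.ge (LieSubmodule.mem_top u)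

/-- The vector `D p₁ (D p₂ (⋯ (D pₖ w)))`, for a list `[p₁, …, pₖ]` of indices of elements of a
Lie algebra. -/
def word (D : ι → g) (w : V) (l : List ι) : V :=
  l.foldr (fun p v ↦ ⁅D p, v⁆) w

variable (R) in
/-- The filtration of a module by the spans of the vectors `word D w l` of total degree less than
`k`, where `D p` has degree `d p`. -/
def wordFiltration (D : ι → g) (w : V) (d : ι → ℕ) (k : ℕ) : Submodule R V :=
  Submodule.span R (word D w '' {l | (l.map d).sum < k})

variable {D : ι → g} {w : V} {d : ι → ℕ}

theorem word_mem_wordFiltration {l : List ι} {k : ℕ} (h : (l.map d).sum < k) :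
    word D w l ∈ wordFiltration R D w d k :=
  Submodule.subset_span ⟨l, h, rfl⟩

theorem wordFiltration_zero : wordFiltration R D w d 0 = ⊥ := by
  simp only [wordFiltration, not_lt_zero, Set.ofPred_false, Set.image_empty, Submodule.span_empty]

theorem wordFiltration_monotone : Monotone (wordFiltration R D w d) := fun _ _ h ↦
  Submodule.span_mono (Set.image_mono fun _ hl ↦ lt_of_lt_of_le hl h)

variable [LieAlgebra R g] [LieModule R g V]

theorem lie_mem_of_mem_span_left {T : Set g} {P : Submodule R V} {v : V}
    (h : ∀ x ∈ T, ⁅x, v⁆ ∈ P) {x : g} (hx : x ∈ Submodule.span R T) : ⁅x, v⁆ ∈ P :=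
  (Submodule.span_le (p := P.comap ((LieModule.toEnd R g V : g →ₗ[R] Module.End R V).flip v))).2
    h hx

theorem lie_mem_of_mem_span_right {T : Set V} {P : Submodule R V} {x : g}
    (h : ∀ v ∈ T, ⁅x, v⁆ ∈ P) {v : V} (hv : v ∈ Submodule.span R T) : ⁅x, v⁆ ∈ P :=
  (Submodule.span_le (p := P.comap (LieModule.toEnd R g V x))).2 h hv

theorem span_range_word_eq_top (hD : Submodule.span R (Set.range D) = ⊤)
    (hw : LieSubmodule.lieSpan R g {w} = ⊤) : Submodule.span R (Set.range (word D w)) = ⊤ := by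
  have hlie (x : g) {v : V} (hv : v ∈ Submodule.span R (Set.range (word D w))) :
      ⁅x, v⁆ ∈ Submodule.span R (Set.range (word D w)) := by
    refine lie_mem_of_mem_span_left (T := Set.range D) ?_ (hD.ge trivial)
    rintro _ ⟨p, rfl⟩
    refine lie_mem_of_mem_span_right ?_ hv
    rintro _ ⟨l, rfl⟩
    exact Submodule.subset_span ⟨p :: l, rfl⟩
  let N : LieSubmodule R g V :=
    { Submodule.span R (Set.range (word D w)) with lie_mem := fun hv ↦ hlie _ hv }
  have hN : N = ⊤ := eq_top_of_mem_of_lieSpan_eq_top hw (Submodule.subset_span ⟨[], rfl⟩)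
  exact congrArg LieSubmodule.toSubmodule hN

theorem exists_mem_wordFiltration (hD : Submodule.span R (Set.range D) = ⊤)
    (hw : LieSubmodule.lieSpan R g {w} = ⊤) (v : V) : ∃ k, v ∈ wordFiltration R D w d k := by
  have hle : Submodule.span R (Set.range (word D w)) ≤ ⨆ k, wordFiltration R D w d k := by
    refine Submodule.span_le.2 ?_
    rintro _ ⟨l, rfl⟩
    exact Submodule.mem_iSup_of_mem _ (word_mem_wordFiltration (Nat.lt_succ_self _))
  exact (Submodule.mem_iSup_of_directed _ wordFiltration_monotone.directed_le).1
    (hle ((span_range_word_eq_top hD hw).ge trivial))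

theorem lie_mem_wordFiltration (p : ι) {k : ℕ} {v : V} (hv : v ∈ wordFiltration R D w d k) :
    ⁅D p, v⁆ ∈ wordFiltration R D w d (d p + k) := by
  refine lie_mem_of_mem_span_right ?_ hv
  rintro _ ⟨l, hl, rfl⟩
  exact word_mem_wordFiltration (l := p :: l) (Nat.add_lt_add_left hl (d p))

end Words

theorem isIrreducible_of_finrank_eq_one {K g V : Type*} [Field K] [LieRing g] [AddCommGroup V]
    [Module K V] [LieRingModule g V] (h : Module.finrank K V = 1) :
    LieModule.IsIrreducible K g V := by
  have : Nontrivial V := Module.nontrivial_of_finrank_eq_succ h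
  have := is_simple_module_of_finrank_eq_one (A := K) h
  exact LieModule.IsIrreducible.mk fun N hN ↦ N.toSubmodule_eq_top.1 <|
    (eq_bot_or_eq_top N.toSubmodule).resolve_left (mt N.toSubmodule_eq_bot.1 hN)

section LoweringDegree

variable {g : Type} [LieRing g] [LieAlgebra ℂ g] {a : LieSubalgebra ℂ g}
  {χ : LieAlgebra.LieCharacter ℂ a}
  {V W : Type} [AddCommGroup V] [Module ℂ V] [LieRingModule g V] [LieModule ℂ g V]
  [AddCommGroup W] [Module ℂ W] [LieRingModule g W] [LieModule ℂ g W]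

theorem exists_mem_whittaker_of_filtration {G : ℕ → Submodule ℂ V} (hG0 : G 0 = ⊥)
    (hG : ∀ v, ∃ k, v ∈ G k)
    (hlow : ∀ (x : a) k, ∀ v ∈ G (k + 1), ⁅(x : g), v⁆ - χ x • v ∈ G k)
    {N : LieSubmodule ℂ g V} (hN : N ≠ ⊥) : ∃ v ∈ N, v ≠ 0 ∧ v ∈ whittaker χ V := by
  obtain ⟨v, hvN, hv0⟩ := N.toSubmodule.exists_mem_ne_zero_of_ne_bot
    (mt N.toSubmodule_eq_bot.1 hN)
  obtain ⟨k, hk⟩ := hG v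
  induction k generalizing v with
  | zero => exact absurd ((Submodule.mem_bot ℂ).1 (hG0 ▸ hk)) hv0
  | succ k ih =>
    by_cases hv : v ∈ whittaker χ V
    · exact ⟨v, hvN, hv0, hv⟩
    · rw [mem_whittaker, not_forall] at hv
      obtain ⟨x, hx⟩ := hv
      exact ih _ (N.sub_mem (N.lie_mem hvN) (N.smul_mem _ hvN)) (sub_ne_zero.2 hx)
        (hlow x k v hk)

variable {ι : Type*} {D : ι → g} {d : ι → ℕ} {w : V}

theorem lie_word_sub_smul_mem_wordFiltration
    (hd : ∀ (x : a) p, ⁅(x : g), D p⁆ ∈ Submodule.span ℂ (D '' {q | d q < d p}))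
    (hw : w ∈ whittaker χ V) (x : a) (l : List ι) :
    ⁅(x : g), word D w l⁆ - χ x • word D w l ∈ wordFiltration ℂ D w d (l.map d).sum := by
  induction l with
  | nil =>
    rw [show word D w [] = w from rfl, mem_whittaker.1 hw x, sub_self]
    exact Submodule.zero_mem _
  | cons p l ih =>
    have hlie : ⁅⁅(x : g), D p⁆, word D w l⁆ ∈ wordFiltration ℂ D w d ((p :: l).map d).sum := by
      refine lie_mem_of_mem_span_left ?_ (hd x p)
      rintro _ ⟨q, hq, rfl⟩
      exact word_mem_wordFiltration (l := q :: l) (Nat.add_lt_add_right hq _)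
    have hleibniz : ⁅(x : g), word D w (p :: l)⁆ - χ x • word D w (p :: l) =
        ⁅⁅(x : g), D p⁆, word D w l⁆ + ⁅D p, ⁅(x : g), word D w l⁆ - χ x • word D w l⁆ := by
      rw [show word D w (p :: l) = ⁅D p, word D w l⁆ from rfl, leibniz_lie, lie_sub, lie_smul]
      abel
    rw [hleibniz]
    exact Submodule.add_mem _ hlie (lie_mem_wordFiltration p ih)

theorem lie_sub_smul_mem_wordFiltration
    (hd : ∀ (x : a) p, ⁅(x : g), D p⁆ ∈ Submodule.span ℂ (D '' {q | d q < d p}))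
    (hw : w ∈ whittaker χ V) (x : a) (k : ℕ) :
    ∀ v ∈ wordFiltration ℂ D w d (k + 1), ⁅(x : g), v⁆ - χ x • v ∈ wordFiltration ℂ D w d k := by
  suffices h : wordFiltration ℂ D w d (k + 1) ≤ (wordFiltration ℂ D w d k).comap
      (LieModule.toEnd ℂ g V x - χ x • LinearMap.id) from h
  refine Submodule.span_le.2 ?_
  rintro _ ⟨l, hl, rfl⟩
  exact wordFiltration_monotone (Nat.lt_succ_iff.1 hl)
    (lie_word_sub_smul_mem_wordFiltration hd hw x l)

theorem isIrreducible_of_finrank_whittaker_eq_one (hD : Submodule.span ℂ (Set.range D) = ⊤)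
    (hd : ∀ (x : a) p, ⁅(x : g), D p⁆ ∈ Submodule.span ℂ (D '' {q | d q < d p}))
    (hw : w ∈ whittaker χ V) (hw0 : w ≠ 0) (hgen : LieSubmodule.lieSpan ℂ g {w} = ⊤)
    (h1 : Module.finrank ℂ (whittaker χ V) = 1) : LieModule.IsIrreducible ℂ g V := by
  have : Nontrivial V := ⟨w, 0, hw0⟩
  refine LieModule.IsIrreducible.mk fun N hN ↦ ?_
  obtain ⟨v, hvN, hv0, hv⟩ := exists_mem_whittaker_of_filtration wordFiltration_zero
    (exists_mem_wordFiltration hD hgen) (lie_sub_smul_mem_wordFiltration hd hw) hN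
  obtain ⟨c, hc⟩ := (finrank_eq_one_iff_of_nonzero' (⟨v, hv⟩ : whittaker χ V)
    fun h ↦ hv0 (congrArg Subtype.val h)).1 h1 ⟨w, hw⟩
  have hcw : c • v = w := congrArg Subtype.val hc
  have hwN : w ∈ N := hcw ▸ N.smul_mem c hvN
  exact eq_top_of_mem_of_lieSpan_eq_top hgen hwN

theorem finrank_whittaker_eq_one_of_injective {f : V →ₗ⁅ℂ,g⁆ W} (hf : Function.Injective f)
    (hw : w ∈ whittaker χ V) (hw0 : w ≠ 0) (h1 : Module.finrank ℂ (whittaker χ W) = 1) :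
    Module.finrank ℂ (whittaker χ V) = 1 := by
  have : Module.Finite ℂ (whittaker χ W) := Module.finite_of_finrank_pos (h1 ▸ one_pos)
  have hinj := whittakerMap_injective (χ := χ) hf
  have : Module.Finite ℂ (whittaker χ V) := Module.Finite.of_injective _ hinj
  have : Nontrivial (whittaker χ V) := ⟨⟨w, hw⟩, 0, fun h ↦ hw0 (congrArg Subtype.val h)⟩
  exact le_antisymm (h1 ▸ LinearMap.finrank_le_finrank_of_injective hinj) Module.finrank_pos

namespace Ind

variable {φ : Ind a (CharModule χ) →ₗ⁅ℂ,g⁆ W}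

theorem exists_mem_whittaker_range (hφ : φ ≠ 0) :
    ∃ w ∈ whittaker χ φ.range, w ≠ 0 ∧ LieSubmodule.lieSpan ℂ g {w} = ⊤ := by
  let ψ : Ind a (CharModule χ) →ₗ⁅ℂ,g⁆ φ.range := φ.codRestrict φ.range φ.mem_range_self
  have hψ : Function.Surjective ψ := fun ⟨_, m, hm⟩ ↦ ⟨m, Subtype.ext hm⟩
  refine ⟨ψ (gen χ), map_mem_whittaker ψ (gen_mem_whittaker χ), fun h ↦ hφ (hom_ext ?_),
    lieSpan_singleton_eq_top_of_surjective hψ (lieSpan_gen_eq_top χ)⟩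
  exact congrArg Subtype.val h

theorem finrank_whittaker_range (hφ : φ ≠ 0) (h1 : Module.finrank ℂ (whittaker χ W) = 1) :
    Module.finrank ℂ (whittaker χ φ.range) = 1 := by
  obtain ⟨w, hw, hw0, _⟩ := exists_mem_whittaker_range hφ
  exact finrank_whittaker_eq_one_of_injective (f := φ.range.incl) Subtype.val_injective hw hw0 h1

theorem isIrreducible_range (hD : Submodule.span ℂ (Set.range D) = ⊤)
    (hd : ∀ (x : a) p, ⁅(x : g), D p⁆ ∈ Submodule.span ℂ (D '' {q | d q < d p}))
    (hφ : φ ≠ 0) (h1 : Module.finrank ℂ (whittaker χ W) = 1) :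
    LieModule.IsIrreducible ℂ g φ.range := by
  obtain ⟨w, hw, hw0, hgen⟩ := exists_mem_whittaker_range hφ
  exact isIrreducible_of_finrank_whittaker_eq_one hD hd hw hw0 hgen
    (finrank_whittaker_range hφ h1)

end Ind

end LoweringDegree

section Degree

variable {n : ℕ}

theorem span_range_D : Submodule.span ℂ (Set.range (D : Idx n → Witt n)) = ⊤ := by
  rw [← (wittBasis n).span_eq, show ⇑(wittBasis n) = D from funext wittBasis_apply]

theorem D_linearIndependent : LinearIndependent ℂ (D : Idx n → Witt n) := by
  rw [← show ⇑(wittBasis n) = D from funext wittBasis_apply]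
  exact (wittBasis n).linearIndependent

theorem exists_eq_e_of_degree_eq_one {m : Fin n →₀ ℕ} (h : m.degree = 1) : ∃ j, m = e j := by
  obtain ⟨j, hj⟩ : ∃ j, m j ≠ 0 := (Finsupp.ne_iff (g := 0)).1 fun h0 ↦ by
    rw [h0, map_zero] at h
    exact zero_ne_one h
  obtain ⟨k, rfl⟩ := eq_e_add hj
  rw [map_add, degree_e, Nat.add_eq_left, Finsupp.degree_eq_zero_iff] at h
  exact ⟨j, by rw [h, add_zero]⟩

variable (r : Fin n → Fin n → Prop)

open Classical in
/-- Positive integers `c_i` that give a grading `deg D_i(m) = ∑ c_k m_k - c_i` of the Witt algebra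
with `𝔫₊`, `𝔥` and `𝔫₋` in negative, zero and positive degrees. For this the `c_i` increase with
respect to `r` and satisfy `max c < 2 * min c`. -/
def coweight (i : Fin n) : ℕ := n + 1 + (Finset.univ.filter fun j ↦ r j i).card

theorem le_coweight (i : Fin n) : n + 1 ≤ coweight r i := Nat.le_add_right _ _

theorem coweight_le (i : Fin n) : coweight r i ≤ 2 * n + 1 := by
  classical
  have h := Finset.card_le_univ (Finset.univ.filter fun j ↦ r j i)
  rw [Fintype.card_fin] at h
  unfold coweight
  convert (by lia : n + 1 + (Finset.univ.filter fun j ↦ r j i).card ≤ 2 * n + 1)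

variable {r} in
theorem coweight_lt [IsStrictTotalOrder (Fin n) r] {i j : Fin n} (h : r i j) :
    coweight r i < coweight r j := by
  classical
  refine Nat.add_lt_add_left (Finset.card_lt_card ?_) _
  rw [Finset.ssubset_iff_of_subset]
  · exact ⟨i, by simpa using h, by simpa using irrefl_of r i⟩
  · intro k hk
    simp only [Finset.mem_filter, Finset.mem_univ, true_and] at hk ⊢
    exact _root_.trans hk h

/-- The degree of `D_i(m)` in the grading defined by `coweight`. -/
def deg (p : Idx n) : ℤ := ∑ k, (p.2 k : ℤ) * coweight r k - coweight r p.1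

theorem deg_e (i j : Fin n) : deg r (i, e j) = coweight r j - coweight r i := by
  simp [deg, e_apply]

theorem neg_le_deg (p : Idx n) : -(2 * n + 1 : ℤ) ≤ deg r p := by
  have hsum : (0 : ℤ) ≤ ∑ k, (p.2 k : ℤ) * coweight r k := by positivity
  have hle := coweight_le r p.1
  unfold deg
  lia

theorem le_deg (p : Idx n) : ((n : ℤ) + 1) * p.2.degree - (2 * n + 1) ≤ deg r p := by
  have hsum : ((n : ℤ) + 1) * p.2.degree ≤ ∑ k, (p.2 k : ℤ) * coweight r k := by
    rw [Finsupp.degree_eq_sum, Nat.cast_sum, Finset.mul_sum]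
    refine Finset.sum_le_sum fun k _ ↦ ?_
    rw [mul_comm]
    gcongr
    exact_mod_cast le_coweight r k
  have hle := coweight_le r p.1
  unfold deg
  lia

theorem torusCoord_D (i k : Fin n) :
    torusCoord k ⟨D (i, e i), D_mem_spanD closed_cartanIdx rfl⟩ = if i = k then 1 else 0 := by
  change (wittBasis n).coord (k, e k) (D (i, e i)) = _
  rw [← wittBasis_apply, Module.Basis.coord_apply, Module.Basis.repr_self, Finsupp.single_apply]
  congr 1
  exact propext ⟨congrArg Prod.fst, fun h ↦ by rw [h]⟩

/-- The element `∑ c_k x_k ∂/∂x_k` of the Cartan subalgebra, with `c_k = coweight r k`; it acts on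
`D_i(m)` by the degree `deg r (i, m)`. -/
def gradingElt : torus n :=
  ∑ k, (coweight r k : ℂ) • ⟨D (k, e k), D_mem_spanD closed_cartanIdx rfl⟩

theorem torusCoord_gradingElt (k : Fin n) : torusCoord k (gradingElt r) = coweight r k := by
  simp only [gradingElt, map_sum, map_smul, torusCoord_D, smul_eq_mul, mul_ite, mul_one, mul_zero,
    Finset.sum_ite_eq', Finset.mem_univ, if_true]

theorem wt_gradingElt (p : Idx n) : wt p (gradingElt r) = (deg r p : ℂ) := by
  simp [wt, deg, torusCoord_gradingElt]

theorem deg_add {p q : Idx n} (h : q.2 p.1 ≠ 0) :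
    deg r (q.1, p.2 + q.2 - e p.1) = deg r p + deg r q := by
  have hwt := congrArg (fun f ↦ f (gradingElt r)) (wt_add h)
  simp only [LinearMap.add_apply, wt_gradingElt] at hwt
  exact_mod_cast hwt

theorem finite_posIdx : (posIdx r).Finite := by
  refine ((Set.finite_range fun i : Fin n ↦ ((i, 0) : Idx n)).union
    (Set.finite_range fun p : Fin n × Fin n ↦ ((p.1, e p.2) : Idx n))).subset ?_
  rintro ⟨i, m⟩ (h | ⟨j, _, h⟩)
  · exact Or.inl ⟨i, Prod.ext rfl h.symm⟩
  · exact Or.inr ⟨(i, j), Prod.ext rfl h.symm⟩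

theorem deg_eq_zero_of_mem_cartanIdx {p : Idx n} (hp : p ∈ cartanIdx n) : deg r p = 0 := by
  obtain ⟨i, m⟩ := p
  obtain rfl : m = e i := hp
  rw [deg_e, sub_self]

/-- The degree of `D_i(m)`, shifted so as to be nonnegative. -/
def natDeg (p : Idx n) : ℕ := (deg r p + (2 * n + 1)).toNat

theorem natDeg_lt_natDeg {p q : Idx n} (h : deg r q < deg r p) : natDeg r q < natDeg r p := by
  have := neg_le_deg r q
  unfold natDeg
  lia

theorem smul_D_mem_span_lower {p q : Idx n} {c : ℕ} (h : c ≠ 0 → deg r q < deg r p) :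
    (c : ℂ) • D q ∈ Submodule.span ℂ (D '' {q | natDeg r q < natDeg r p}) := by
  rcases eq_or_ne c 0 with rfl | hc
  · rw [Nat.cast_zero, zero_smul]
    exact Submodule.zero_mem _
  · exact Submodule.smul_mem _ _ (Submodule.subset_span ⟨q, natDeg_lt_natDeg r (h hc), rfl⟩)

variable [IsStrictTotalOrder (Fin n) r]

variable {r} in
theorem deg_neg_of_mem_posIdx {p : Idx n} (hp : p ∈ posIdx r) : deg r p < 0 := by
  obtain ⟨i, m⟩ := p
  rcases hp with (rfl : m = 0) | ⟨j, hj, rfl : m = e j⟩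
  · have := le_coweight r i
    simp only [deg, Finsupp.coe_zero, Pi.zero_apply, Nat.cast_zero, zero_mul, Finset.sum_const_zero]
    lia
  · rw [deg_e]
    exact sub_neg.2 (Nat.cast_lt.2 (coweight_lt hj))

variable {r} in
theorem deg_pos_of_mem_negIdx {p : Idx n} (hp : p ∈ negIdx r) : 0 < deg r p := by
  obtain ⟨i, m⟩ := p
  rcases hp with ⟨j, hj, rfl : m = e j⟩ | hm
  · rw [deg_e]
    exact sub_pos.2 (Nat.cast_lt.2 (coweight_lt hj))
  · have hdeg := le_deg r (i, m)
    have hle : ((n : ℤ) + 1) * 2 ≤ (n + 1) * m.degree := by gcongr; exact_mod_cast hm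
    simp only at hdeg
    lia

theorem mem_posIdx_or_mem_cartanIdx_or_mem_negIdx (p : Idx n) :
    p ∈ posIdx r ∨ p ∈ cartanIdx n ∨ p ∈ negIdx r := by
  obtain ⟨i, m⟩ := p
  obtain h | h | h : m.degree = 0 ∨ m.degree = 1 ∨ 2 ≤ m.degree := by lia
  · exact Or.inl (Or.inl ((Finsupp.degree_eq_zero_iff m).1 h))
  · obtain ⟨j, rfl⟩ := exists_eq_e_of_degree_eq_one h
    rcases trichotomous_of r i j with hij | rfl | hji
    · exact Or.inr (Or.inr (Or.inl ⟨j, hij, rfl⟩))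
    · exact Or.inr (Or.inl rfl)
    · exact Or.inl (Or.inr ⟨j, hji, rfl⟩)
  · exact Or.inr (Or.inr (Or.inr h))

theorem isCompl_nPos_bNeg : IsCompl (nPos r).toSubmodule (bNeg r).toSubmodule := by
  refine D_linearIndependent.isCompl_span_image span_range_D ⟨Set.disjoint_left.2 ?_,
    codisjoint_iff.2 (Set.eq_univ_of_forall (mem_posIdx_or_mem_cartanIdx_or_mem_negIdx r))⟩
  rintro p hp (hp' | hp')
  · exact (deg_neg_of_mem_posIdx hp).ne (deg_eq_zero_of_mem_cartanIdx r hp')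
  · exact (deg_neg_of_mem_posIdx hp).not_gt (deg_pos_of_mem_negIdx hp')

theorem nNeg_sup_bPos : (nNeg r).toSubmodule ⊔ (bPos r).toSubmodule = ⊤ := by
  have h : negIdx r ∪ (cartanIdx n ∪ posIdx r) = Set.univ := Set.eq_univ_of_forall fun p ↦ by
    have := mem_posIdx_or_mem_cartanIdx_or_mem_negIdx r p
    simp only [Set.mem_union]
    tauto
  change Submodule.span ℂ _ ⊔ Submodule.span ℂ _ = _
  rw [← Submodule.span_union, ← Set.image_union, h, Set.image_univ, span_range_D]

theorem lie_D_mem_span_lower (x : nPos r) (p : Idx n) :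
    ⁅(x : Witt n), D p⁆ ∈ Submodule.span ℂ (D '' {q | natDeg r q < natDeg r p}) := by
  refine lie_mem_of_mem_span_left (T := D '' posIdx r) ?_ x.2
  rintro _ ⟨q, hq, rfl⟩
  have hdeg := deg_neg_of_mem_posIdx hq
  change ⁅D q, D p⁆ ∈ _
  rw [lie_D]
  refine Submodule.sub_mem _ (smul_D_mem_span_lower r fun h ↦ ?_)
    (smul_D_mem_span_lower r fun h ↦ ?_)
  · rw [deg_add r h]
    lia
  · rw [add_comm q.2, deg_add r h]
    lia

end Degree

section Weights

variable {n : ℕ}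

theorem lie_torus_torus (h h' : torus n) : ⁅(h : Witt n), (h' : Witt n)⁆ = 0 := by
  refine lie_mem_of_mem_span_right (g := Witt n) (V := Witt n) (P := (⊥ : Submodule ℂ (Witt n)))
    (T := D '' cartanIdx n) ?_ h'.2
  rintro _ ⟨⟨i, m⟩, hp : m = e i, rfl⟩
  have hwt : wt (i, m) h = 0 := by simp [wt, hp, e_apply]
  change ⁅(h : Witt n), D (i, m)⁆ = 0
  rw [lie_torus_D, hwt, zero_smul]

theorem torusProj_coe (h : torus n) : torusProj n (h : Witt n) = h := by
  have hle : Submodule.span ℂ (D '' cartanIdx n) ≤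
      LinearMap.eqLocus ((torus n).toSubmodule.subtype ∘ₗ torusProj n) LinearMap.id := by
    refine Submodule.span_le.2 ?_
    rintro _ ⟨p, hp, rfl⟩
    change ((torusProj n (D p) : torus n) : Witt n) = D p
    rw [← wittBasis_apply, torusProj, Module.Basis.constr_basis, dif_pos hp, wittBasis_apply]
  exact Subtype.ext (hle h.2)

variable {V W : Type} [AddCommGroup V] [Module ℂ V] [LieRingModule (Witt n) V]
  [LieModule ℂ (Witt n) V] [AddCommGroup W] [Module ℂ W] [LieRingModule (Witt n) W]
  [LieModule ℂ (Witt n) W] {μ ν : Module.Dual ℂ (torus n)} {v : V}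

theorem map_mem_wtSpace (f : V →ₗ⁅ℂ,Witt n⁆ W) (hv : v ∈ wtSpace V ν) : f v ∈ wtSpace W ν :=
  fun h ↦ by rw [← LieModuleHom.map_lie, hv h, map_smul]

variable (V) in
theorem iSupIndep_wtSpace : iSupIndep fun ν : Module.Dual ℂ (torus n) ↦ wtSpace V ν := by
  let f (h : torus n) : Module.End ℂ V := LieModule.toEnd ℂ (Witt n) V (h : Witt n)
  have hcomm (h h' : torus n) : Commute (f h) (f h') := by
    rw [commute_iff_lie_eq, ← LieHom.map_lie, lie_torus_torus, map_zero]
  have hindep := Module.End.independent_iInf_maxGenEigenspace_of_forall_mapsTo f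
    fun h h' c ↦ Module.End.mapsTo_maxGenEigenspace_of_comm (hcomm h' h) c
  refine (hindep.comp (f := fun ν : Module.Dual ℂ (torus n) ↦ (ν : torus n → ℂ))
    DFunLike.coe_injective).mono fun ν v hv ↦ (Submodule.mem_iInf _).2 fun h ↦ ?_
  exact ((f h).genEigenspace (ν h)).monotone le_top (Module.End.mem_eigenspace_iff.2 (hv h))

/-- A weight module: a module over the Witt algebra that is the sum of its weight spaces. The sum
is direct by `iSupIndep_wtSpace`. -/
def IsWeightModule (n : ℕ) (V : Type) [AddCommGroup V] [Module ℂ V] [LieRingModule (Witt n) V]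
    [LieModule ℂ (Witt n) V] : Prop :=
  ⨆ ν : Module.Dual ℂ (torus n), wtSpace V ν = ⊤

theorem IsWeightModule.linearMap_ext {A : Type*} [AddCommGroup A] [Module ℂ A]
    (hV : IsWeightModule n V) {F G : V →ₗ[ℂ] A}
    (h : ∀ ν : Module.Dual ℂ (torus n), ∀ v ∈ wtSpace V ν, F v = G v) : F = G :=
  LinearMap.ext fun v ↦ (iSup_le h : _ ≤ LinearMap.eqLocus F G) (hV.ge (Submodule.mem_top (x := v)))

theorem word_mem_wtSpace (hv : v ∈ wtSpace V ν) (l : List (Idx n)) :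
    word D v l ∈ wtSpace V (ν + (l.map wt).sum) := by
  induction l with
  | nil => rwa [List.map_nil, List.sum_nil, add_zero]
  | cons p l ih =>
    refine lie_D_mem ?_ ih
    rw [List.map_cons, List.sum_cons]
    abel

theorem isWeightModule_of_lieSpan_eq_top (hv : v ∈ wtSpace V ν)
    (hgen : LieSubmodule.lieSpan ℂ (Witt n) {v} = ⊤) : IsWeightModule n V := by
  refine top_le_iff.1 ((span_range_word_eq_top span_range_D hgen).ge.trans (Submodule.span_le.2 ?_))
  rintro _ ⟨l, rfl⟩
  exact Submodule.mem_iSup_of_mem _ (word_mem_wtSpace hv l)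

theorem wtSpace_eq_span {I : Type*} {b : I → V} {w : I → Module.Dual ℂ (torus n)}
    (hb : ∀ i, b i ∈ wtSpace V (w i)) (hspan : Submodule.span ℂ (Set.range b) = ⊤)
    (ν : Module.Dual ℂ (torus n)) : wtSpace V ν = Submodule.span ℂ (b '' {i | w i = ν}) := by
  have hle : (fun ν ↦ Submodule.span ℂ (b '' {i | w i = ν})) ≤ fun ν ↦ wtSpace V ν := by
    refine fun ν ↦ Submodule.span_le.2 ?_
    rintro _ ⟨i, rfl, rfl⟩
    exact hb i
  have htop : ⨆ ν, Submodule.span ℂ (b '' {i | w i = ν}) = ⊤ := by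
    refine top_le_iff.1 (hspan.ge.trans (Submodule.span_le.2 ?_))
    rintro _ ⟨i, rfl⟩
    exact Submodule.mem_iSup_of_mem (w i) (Submodule.subset_span ⟨i, rfl, rfl⟩)
  exact (congrFun (((iSupIndep_wtSpace V).le_iff_eq_of_iSup_eq_top htop).1 hle) ν).symm

section Generators

variable {S : Set (Idx n)}

theorem mem_whittaker_extendChar_iff (hS : IsClosedIdx S) (hd : ∀ p ∈ S, p ∉ cartanIdx n) :
    v ∈ whittaker (extendChar hS hd μ) V ↔ v ∈ wtSpace V μ ∧ ∀ p ∈ S, ⁅D p, v⁆ = 0 := by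
  rw [mem_whittaker]
  refine ⟨fun hv ↦ ⟨fun h ↦ ?_, fun p hp ↦ ?_⟩, fun ⟨hμ, h0⟩ x ↦ ?_⟩
  · refine (hv ⟨h, Submodule.span_mono (Set.image_mono Set.subset_union_left) h.2⟩).trans ?_
    exact congrArg (fun t ↦ μ t • v) (torusProj_coe h)
  · refine (hv ⟨D p, D_mem_spanD _ (Or.inr hp)⟩).trans ?_
    change μ (torusProj n (D p)) • v = 0
    rw [torusProj_D_of_notMem (hd p hp), map_zero, zero_smul]
  · have hle : Submodule.span ℂ (D '' (cartanIdx n ∪ S)) ≤ LinearMap.eqLocus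
        ((LieModule.toEnd ℂ (Witt n) V : Witt n →ₗ[ℂ] Module.End ℂ V).flip v)
        ((μ ∘ₗ torusProj n).smulRight v) := by
      refine Submodule.span_le.2 ?_
      rintro _ ⟨p, hp | hp, rfl⟩
      · have hproj := torusProj_coe ⟨D p, D_mem_spanD closed_cartanIdx hp⟩
        exact (hμ ⟨D p, D_mem_spanD _ hp⟩).trans (congrArg (fun t ↦ μ t • v) hproj.symm)
      · change ⁅D p, v⁆ = μ (torusProj n (D p)) • v
        rw [torusProj_D_of_notMem (hd p hp), map_zero, zero_smul, h0 p hp]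
    exact hle x.2

theorem gen_extendChar_mem_wtSpace (hS : IsClosedIdx S) (hd : ∀ p ∈ S, p ∉ cartanIdx n) :
    Ind.gen (extendChar hS hd μ) ∈ wtSpace (Ind _ (CharModule (extendChar hS hd μ))) μ :=
  ((mem_whittaker_extendChar_iff hS hd).1 (Ind.gen_mem_whittaker _)).1

theorem span_range_word_subtype_eq_top {hS : IsClosedIdx S}
    (hv : LieSubmodule.lieSpan ℂ (spanD S hS) {v} = ⊤) :
    Submodule.span ℂ (Set.range fun l : List S ↦ word D v (l.map Subtype.val)) = ⊤ := by
  let DS (p : S) : spanD S hS := ⟨D p, D_mem_spanD hS p.2⟩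
  have hDS : Submodule.span ℂ (Set.range DS) = ⊤ := by
    refine Submodule.map_injective_of_injective (spanD S hS).toSubmodule.injective_subtype ?_
    rw [Submodule.map_span, ← Set.range_comp, Submodule.map_top, Submodule.range_subtype]
    exact congrArg (Submodule.span ℂ) (Set.image_eq_range D S).symm
  rw [← span_range_word_eq_top hDS hv]
  exact congrArg (fun f ↦ Submodule.span ℂ (Set.range f)) (funext fun _ ↦ List.foldr_map)

end Generators

theorem wt_sum_gradingElt (r : Fin n → Fin n → Prop) (l : List (Idx n)) :
    (l.map wt).sum (gradingElt r) = ((l.map (deg r)).sum : ℂ) := by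
  induction l with
  | nil => simp
  | cons p l ih =>
    rw [List.map_cons, List.sum_cons, LinearMap.add_apply, ih, wt_gradingElt, List.map_cons,
      List.sum_cons, Int.cast_add]

variable {r : Fin n → Fin n → Prop} [IsStrictTotalOrder (Fin n) r]

theorem length_le_neg_sum_deg (l : List (posIdx r)) :
    (l.length : ℤ) ≤ -((l.map Subtype.val).map (deg r)).sum := by
  induction l with
  | nil => simp
  | cons p l ih =>
    have hp := deg_neg_of_mem_posIdx p.2
    simp only [List.map_cons, List.sum_cons, List.length_cons] at ih ⊢
    lia

variable (r) in
theorem finite_setOf_sum_wt_eq (ν : Module.Dual ℂ (torus n)) :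
    {l : List (posIdx r) | ((l.map Subtype.val).map wt).sum = ν}.Finite := by
  have := (finite_posIdx r).to_subtype
  refine (List.finite_length_le (posIdx r) ⌊‖ν (gradingElt r)‖⌋₊).subset fun l hl ↦ ?_
  have hdeg : ν (gradingElt r) = (((l.map Subtype.val).map (deg r)).sum : ℂ) := by
    rw [← wt_sum_gradingElt, hl]
  have hlen : (l.length : ℤ) ≤ |((l.map Subtype.val).map (deg r)).sum| :=
    (length_le_neg_sum_deg l).trans (neg_le_abs _)
  refine Nat.le_floor ?_
  rw [hdeg, Complex.norm_intCast]
  exact_mod_cast hlen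

theorem finite_wtSpace (hv : v ∈ wtSpace V μ) (hgen : LieSubmodule.lieSpan ℂ (nPos r) {v} = ⊤)
    (ν : Module.Dual ℂ (torus n)) : Module.Finite ℂ (wtSpace V ν) := by
  rw [wtSpace_eq_span (fun l : List (posIdx r) ↦ word_mem_wtSpace hv (l.map Subtype.val))
    (span_range_word_subtype_eq_top hgen) ν]
  refine Module.Finite.span_of_finite ℂ (Set.Finite.image _ ?_)
  exact (finite_setOf_sum_wt_eq r (ν - μ)).subset fun l hl ↦ eq_sub_of_add_eq' hl

end Weights

section Duality

variable {n : ℕ} {L M : Type} [AddCommGroup L] [Module ℂ L] [LieRingModule (Witt n) L]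
  [LieModule ℂ (Witt n) L] [AddCommGroup M] [Module ℂ M] [LieRingModule (Witt n) M]
  [LieModule ℂ (Witt n) M] {κ ν : Module.Dual ℂ (torus n)}

theorem apply_eq_zero_of_mem_wtSpace (j : L →ₗ⁅ℂ,Witt n⁆ Module.Dual ℂ M) (h : ν ≠ -κ) {x : L}
    (hx : x ∈ wtSpace L κ) {m : M} (hm : m ∈ wtSpace M ν) : j x m = 0 := by
  obtain ⟨t, ht⟩ : ∃ t, ν t ≠ (-κ) t := by
    by_contra! hc
    exact h (LinearMap.ext hc)
  have hinv : j ⁅(t : Witt n), x⁆ m = -j x ⁅(t : Witt n), m⁆ := by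
    rw [LieModuleHom.map_lie, Module.Dual.lie_apply]
  rw [hx t, hm t, map_smul, map_smul, LinearMap.smul_apply, smul_eq_mul, smul_eq_mul] at hinv
  have hmul : (ν t + κ t) * j x m = 0 := by linear_combination hinv
  exact (mul_eq_zero.1 hmul).resolve_left fun h0 ↦ ht (eq_neg_of_add_eq_zero_left h0)

/-- The restriction of an invariant pairing to the weight spaces of weights `-ν` and `ν`. -/
def weightPairing (j : L →ₗ⁅ℂ,Witt n⁆ Module.Dual ℂ M) (ν : Module.Dual ℂ (torus n)) :
    wtSpace L (-ν) →ₗ[ℂ] Module.Dual ℂ (wtSpace M ν) :=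
  (wtSpace M ν).subtype.dualMap ∘ₗ (j : L →ₗ[ℂ] Module.Dual ℂ M) ∘ₗ (wtSpace L (-ν)).subtype

theorem weightPairing_bijective (hL : IsWeightModule n L) (hM : IsWeightModule n M)
    [Module.Finite ℂ (wtSpace M ν)] {j : L →ₗ⁅ℂ,Witt n⁆ Module.Dual ℂ M}
    (hj : Function.Injective j) (hsep : ∀ m, (∀ x, j x m = 0) → m = 0) :
    Function.Bijective (weightPairing j ν) := by
  have hleft : Function.Injective (weightPairing j ν) := by
    refine (injective_iff_map_eq_zero _).2 fun x hx ↦ Subtype.ext (hj ?_)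
    refine (hM.linearMap_ext fun κ m hm ↦ ?_).trans (map_zero j).symm
    by_cases hκ : κ = ν
    · subst hκ
      exact LinearMap.congr_fun hx ⟨m, hm⟩
    · exact apply_eq_zero_of_mem_wtSpace j (by rwa [neg_neg]) x.2 hm
  have hright : Function.Injective (weightPairing j ν).flip := by
    refine (injective_iff_map_eq_zero _).2 fun m hm ↦ Subtype.ext (hsep m fun x ↦ ?_)
    refine LinearMap.congr_fun (f := (j : L →ₗ[ℂ] Module.Dual ℂ M).flip m) (g := 0)
      (hL.linearMap_ext fun κ x hx ↦ ?_) x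
    by_cases hκ : κ = -ν
    · subst hκ
      exact LinearMap.congr_fun hm ⟨x, hx⟩
    · exact apply_eq_zero_of_mem_wtSpace j (fun h ↦ hκ (by rw [h, neg_neg])) hx m.2
  have := LinearMap.IsPerfPair.of_injective' hleft hright
  exact LinearMap.IsPerfPair.bijective_left (weightPairing j ν)

theorem exists_completion_linearEquiv_dual (hM : IsWeightModule n M)
    {j : L →ₗ⁅ℂ,Witt n⁆ Module.Dual ℂ M} (hj : ∀ ν, Function.Bijective (weightPairing j ν)) :
    ∃ E : Completion n L ≃ₗ[ℂ] Module.Dual ℂ M,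
      ∀ f ν, ∀ m ∈ wtSpace M ν, E f m = j (f.comp (-ν)) m := by
  classical
  have hint : DirectSum.IsInternal fun ν : Module.Dual ℂ (torus n) ↦ wtSpace M ν :=
    DirectSum.isInternal_submodule_of_iSupIndep_of_iSup_eq_top (iSupIndep_wtSpace M) hM
  let decomposition := LinearEquiv.ofBijective
    (DirectSum.coeLinearMap fun ν : Module.Dual ℂ (torus n) ↦ wtSpace M ν) hint
  let reindex : Completion n L ≃ₗ[ℂ] ((ν : Module.Dual ℂ (torus n)) → wtSpace L (-ν)) :=
    LinearEquiv.piCongrLeft' ℂ (fun κ ↦ wtSpace L κ) (Equiv.neg _)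
  refine ⟨reindex ≪≫ₗ LinearEquiv.piCongrRight (fun ν ↦ LinearEquiv.ofBijective _ (hj ν)) ≪≫ₗ
    DFinsupp.lsum ℂ ≪≫ₗ decomposition.symm.dualMap, fun f ν m hm ↦ ?_⟩
  have hdec : decomposition.symm m = DFinsupp.single ν ⟨m, hm⟩ :=
    (LinearEquiv.symm_apply_eq _).2 (DirectSum.coeLinearMap_lof _ ν ⟨m, hm⟩).symm
  change DFinsupp.lsum ℂ _ (decomposition.symm m) = _
  rw [hdec, DFinsupp.lsum_single]
  rfl

theorem map_lie_of_forall_wtSpace (hM : IsWeightModule n M) {j : L →ₗ⁅ℂ,Witt n⁆ Module.Dual ℂ M}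
    {E : Completion n L →ₗ[ℂ] Module.Dual ℂ M}
    (hE : ∀ f ν, ∀ m ∈ wtSpace M ν, E f m = j (f.comp (-ν)) m) (x : Witt n) (f : Completion n L) :
    E ⁅x, f⁆ = ⁅x, E f⁆ := by
  suffices h :
      E ∘ₗ LinearMap.applyₗ f ∘ₗ (LieModule.toEnd ℂ (Witt n) (Completion n L)).toLinearMap =
        LinearMap.applyₗ (E f) ∘ₗ (LieModule.toEnd ℂ (Witt n) (Module.Dual ℂ M)).toLinearMap from
    LinearMap.congr_fun h x
  refine LinearMap.ext_on_range span_range_D fun p ↦ ?_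
  change E ⁅D p, f⁆ = ⁅D p, E f⁆
  refine hM.linearMap_ext fun ν m hm ↦ ?_
  have hcomp : (⁅D p, f⁆ : Completion n L).comp (-ν) = ⁅D p, f.comp (-ν - wt p)⁆ := by
    rw [Completion.lie_def, Completion.act_D, Completion.comp_actD]
  rw [hE _ ν m hm, hcomp, LieModuleHom.map_lie, Module.Dual.lie_apply, Module.Dual.lie_apply,
    hE f (ν + wt p) _ (lie_D_mem rfl hm), neg_add']

theorem nonempty_completion_equiv_dual (hL : IsWeightModule n L) (hM : IsWeightModule n M)
    (hfin : ∀ ν : Module.Dual ℂ (torus n), Module.Finite ℂ (wtSpace M ν))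
    {j : L →ₗ⁅ℂ,Witt n⁆ Module.Dual ℂ M} (hj : Function.Injective j)
    (hsep : ∀ m, (∀ x, j x m = 0) → m = 0) :
    Nonempty (Completion n L ≃ₗ⁅ℂ,Witt n⁆ Module.Dual ℂ M) := by
  obtain ⟨E, hE⟩ := exists_completion_linearEquiv_dual hM
    fun ν ↦ weightPairing_bijective (ν := ν) hL hM hj hsep
  exact ⟨{ E with map_lie' := fun {x f} ↦ map_lie_of_forall_wtSpace hM (E := E) hE x f }⟩

end Duality

theorem exists_injective_of_eq_ker {R g M N : Type*} [CommRing R] [LieRing g] [LieAlgebra R g]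
    [AddCommGroup M] [Module R M] [LieRingModule g M] [LieModule R g M] [AddCommGroup N]
    [Module R N] [LieRingModule g N] {f : M →ₗ⁅R,g⁆ N}
    {K : LieSubmodule R g M} (hK : K = f.ker) :
    ∃ j : (M ⧸ K) →ₗ⁅R,g⁆ N, Function.Injective j ∧
      ∀ m, j (LieSubmodule.Quotient.mk' K m) = f m := by
  subst hK
  let j : (M ⧸ f.ker) →ₗ[R] N := f.ker.toSubmodule.liftQ (f : M →ₗ[R] N) le_rfl
  refine ⟨{ j with map_lie' := fun {x m} ↦ ?_ }, ?_, fun _ ↦ rfl⟩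
  · obtain ⟨m, rfl⟩ := LieSubmodule.Quotient.surjective_mk' f.ker m
    exact f.map_lie x m
  · exact LinearMap.ker_eq_bot.1 (Submodule.ker_liftQ_eq_bot _ _ _ le_rfl)

section HighestWeight

variable {n : ℕ} {V : Type} [AddCommGroup V] [Module ℂ V] [LieRingModule (Witt n) V]
  [LieModule ℂ (Witt n) V] {W : Type} [AddCommGroup W] [Module ℂ W] [LieRingModule (Witt n) W]
  [LieModule ℂ (Witt n) W] {v : V}

theorem mem_whittaker_zero_iff {S : Set (Idx n)} (hS : IsClosedIdx S) :
    v ∈ whittaker (0 : LieAlgebra.LieCharacter ℂ (spanD S hS)) V ↔ ∀ p ∈ S, ⁅D p, v⁆ = 0 := by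
  simp only [mem_whittaker, LieHom.zero_apply, zero_smul]
  refine ⟨fun h p hp ↦ h ⟨D p, D_mem_spanD hS hp⟩, fun h x ↦ ?_⟩
  refine lie_mem_of_mem_span_left (P := (⊥ : Submodule ℂ V)) ?_ x.2
  rintro _ ⟨p, hp, rfl⟩
  exact h p hp

theorem lie_torus_mem_whittaker_zero {S : Set (Idx n)} {hS : IsClosedIdx S}
    (hv : v ∈ whittaker (0 : LieAlgebra.LieCharacter ℂ (spanD S hS)) V) (h : torus n) :
    ⁅(h : Witt n), v⁆ ∈ whittaker (0 : LieAlgebra.LieCharacter ℂ (spanD S hS)) V := by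
  rw [mem_whittaker_zero_iff] at hv ⊢
  intro p hp
  have hwt : ⁅(h : Witt n), D p⁆ = wt p h • D p := lie_torus_D h p
  have hleib := leibniz_lie (h : Witt n) (D p) v
  rwa [hwt, smul_lie (wt p h) (D p) v, hv p hp, lie_zero, smul_zero, zero_add, eq_comm] at hleib

variable {μ : Module.Dual ℂ (torus n)}

theorem le_iSup_wtSpace_ne (hv : v ∈ wtSpace V μ)
    (hgen : LieSubmodule.lieSpan ℂ (Witt n) {v} = ⊤)
    (hsup : Submodule.span ℂ {v} ⊔ ⨆ ν ≠ μ, wtSpace V ν = ⊤) {N : LieSubmodule ℂ (Witt n) V}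
    (hN : N ≠ ⊤) : N.toSubmodule ≤ ⨆ ν ≠ μ, wtSpace V ν := by
  intro x hx
  obtain ⟨_, hc, y, hy, rfl⟩ := Submodule.mem_sup.1 (hsup.ge (Submodule.mem_top (x := x)))
  obtain ⟨c, rfl⟩ := Submodule.mem_span_singleton.1 hc
  let π := LieSubmodule.Quotient.mk' N
  have hπ : π (c • v) = -π y := by
    rw [← add_eq_zero_iff_eq_neg, ← map_add]
    exact (LieSubmodule.Quotient.mk_eq_zero N).2 hx
  have hle : ⨆ ν ≠ μ, wtSpace V ν ≤ (⨆ ν ≠ μ, wtSpace (V ⧸ N) ν).comap (π : V →ₗ[ℂ] V ⧸ N) :=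
    iSup₂_le fun ν hν _ hz ↦
      Submodule.mem_iSup_of_mem ν (Submodule.mem_iSup_of_mem hν (map_mem_wtSpace π hz))
  have hzero : π (c • v) = 0 :=
    Submodule.disjoint_def.1 (iSupIndep_wtSpace (V ⧸ N) μ) _
      (map_mem_wtSpace π (Submodule.smul_mem _ c hv)) (hπ ▸ Submodule.neg_mem _ (hle hy))
  have hcv : c • v ∈ N := (LieSubmodule.Quotient.mk_eq_zero N).1 hzero
  obtain rfl | hc0 := eq_or_ne c 0
  · rwa [zero_smul, zero_add]
  · have hvN : v ∈ N := (N.toSubmodule.smul_mem_iff hc0).1 hcv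
    exact absurd (eq_top_of_mem_of_lieSpan_eq_top hgen hvN) hN

theorem le_ker_of_ne_top (f : V →ₗ⁅ℂ,Witt n⁆ Module.Dual ℂ W) (hv : v ∈ wtSpace V μ)
    (hv_gen : LieSubmodule.lieSpan ℂ (Witt n) {v} = ⊤)
    (hsup : Submodule.span ℂ {v} ⊔ ⨆ ν ≠ μ, wtSpace V ν = ⊤) {w : W} (hw : w ∈ wtSpace W (-μ))
    (hw_gen : LieSubmodule.lieSpan ℂ (Witt n) {w} = ⊤) {N : LieSubmodule ℂ (Witt n) V}
    (hN : N ≠ ⊤) : N ≤ f.ker := by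
  have hle : ⨆ ν ≠ μ, wtSpace V ν ≤ LinearMap.ker ((f : V →ₗ[ℂ] Module.Dual ℂ W).flip w) :=
    iSup₂_le fun ν hν x hx ↦
      apply_eq_zero_of_mem_wtSpace f (fun h ↦ hν (neg_injective h).symm) hx hw
  have hmem : w ∈ coannihilator (f.comp N.incl) :=
    mem_coannihilator.2 fun x ↦ hle (le_iSup_wtSpace_ne hv hv_gen hsup hN x.2)
  have htop := eq_top_of_mem_of_lieSpan_eq_top hw_gen hmem
  exact fun x hx ↦ f.mem_ker.2 (LinearMap.ext fun m ↦ mem_coannihilator.1 (htop.ge trivial) ⟨x, hx⟩)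

variable {r : Fin n → Fin n → Prop} [IsStrictTotalOrder (Fin n) r]

theorem sum_deg_pos {l : List (negIdx r)} (hl : l ≠ []) :
    0 < ((l.map Subtype.val).map (deg r)).sum := by
  refine List.sum_pos _ (fun k hk ↦ ?_) (by simpa only [ne_eq, List.map_eq_nil_iff] using hl)
  obtain ⟨p, hp, rfl⟩ := List.mem_map.1 hk
  obtain ⟨q, _, rfl⟩ := List.mem_map.1 hp
  exact deg_pos_of_mem_negIdx q.2

theorem span_singleton_sup_iSup_wtSpace_ne (hv : v ∈ wtSpace V μ)
    (hgen : LieSubmodule.lieSpan ℂ (nNeg r) {v} = ⊤) :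
    Submodule.span ℂ {v} ⊔ ⨆ ν ≠ μ, wtSpace V ν = ⊤ := by
  refine top_le_iff.1 ((span_range_word_subtype_eq_top hgen).ge.trans (Submodule.span_le.2 ?_))
  rintro _ ⟨l, rfl⟩
  by_cases hl : l = []
  · subst hl
    exact Submodule.mem_sup_left (Submodule.mem_span_singleton_self v)
  · refine Submodule.mem_sup_right (Submodule.mem_iSup_of_mem _ (Submodule.mem_iSup_of_mem ?_
      (word_mem_wtSpace hv (l.map Subtype.val))))
    intro h
    have hdeg := wt_sum_gradingElt r (l.map Subtype.val)
    rw [add_eq_left.1 h, LinearMap.zero_apply, eq_comm, Int.cast_eq_zero] at hdeg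
    exact (sum_deg_pos hl).ne' hdeg

/-- The canonical generator of `M⁺(μ)`. -/
abbrev genPos (r : Fin n → Fin n → Prop) [IsStrictTotalOrder (Fin n) r]
    (μ : Module.Dual ℂ (torus n)) : MPos r μ :=
  Ind.gen (extendChar (closed_posIdx r) (fun _ ↦ posIdx_disjoint r) μ)

/-- The canonical generator of `M⁻(μ)`. -/
abbrev genNeg (r : Fin n → Fin n → Prop) [IsStrictTotalOrder (Fin n) r]
    (μ : Module.Dual ℂ (torus n)) : MNeg r μ :=
  Ind.gen (extendChar (closed_negIdx r) (fun _ ↦ negIdx_disjoint r) μ)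

theorem genNeg_mem_wtSpace : genNeg r μ ∈ wtSpace (MNeg r μ) μ :=
  gen_extendChar_mem_wtSpace (closed_negIdx r) fun _ ↦ negIdx_disjoint r

theorem genPos_mem_wtSpace : genPos r μ ∈ wtSpace (MPos r μ) μ :=
  gen_extendChar_mem_wtSpace (closed_posIdx r) fun _ ↦ posIdx_disjoint r

theorem lieSpan_genPos (r : Fin n → Fin n → Prop) [IsStrictTotalOrder (Fin n) r]
    (μ : Module.Dual ℂ (torus n)) : LieSubmodule.lieSpan ℂ (Witt n) {genPos r μ} = ⊤ :=
  Ind.lieSpan_gen_eq_top _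

theorem lieSpan_genNeg (r : Fin n → Fin n → Prop) [IsStrictTotalOrder (Fin n) r]
    (μ : Module.Dual ℂ (torus n)) : LieSubmodule.lieSpan ℂ (Witt n) {genNeg r μ} = ⊤ :=
  Ind.lieSpan_gen_eq_top _

theorem mem_wtSpace_of_mem_whittaker_dual {F : Module.Dual ℂ (MNeg r (-μ))}
    (hF : F ∈ whittaker (0 : LieAlgebra.LieCharacter ℂ (nPos r)) (Module.Dual ℂ _)) :
    F ∈ wtSpace (Module.Dual ℂ (MNeg r (-μ))) μ := by
  intro h
  refine sub_eq_zero.1 (eq_zero_of_mem_whittaker_dual (isCompl_nPos_bNeg r).sup_eq_top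
    (sub_mem (lie_torus_mem_whittaker_zero hF h) (SMulMemClass.smul_mem (μ h) hF)) ?_)
  rw [LinearMap.sub_apply, Module.Dual.lie_apply, genNeg_mem_wtSpace h, map_smul,
    LinearMap.neg_apply, neg_smul, neg_neg, LinearMap.smul_apply, sub_self]

theorem exists_pairing (r : Fin n → Fin n → Prop) [IsStrictTotalOrder (Fin n) r]
    (μ : Module.Dual ℂ (torus n)) : ∃ Φ : MPos r μ →ₗ⁅ℂ,Witt n⁆ Module.Dual ℂ (MNeg r (-μ)),
    Φ (genPos r μ) (genNeg r (-μ)) = 1 := by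
  obtain ⟨F, hF, hF1⟩ := exists_mem_whittaker_dual_gen_eq_one (isCompl_nPos_bNeg r)
    (extendChar (closed_negIdx r) (fun _ ↦ negIdx_disjoint r) (-μ)) 0
  have hFμ : F ∈ whittaker (extendChar (closed_posIdx r) (fun _ ↦ posIdx_disjoint r) μ)
      (Module.Dual ℂ (MNeg r (-μ))) :=
    (mem_whittaker_extendChar_iff _ _).2
      ⟨mem_wtSpace_of_mem_whittaker_dual hF, (mem_whittaker_zero_iff _).1 hF⟩
  exact ⟨Ind.lift _ ⟨F, hFμ⟩, by rw [Ind.lift_gen]; exact hF1⟩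

theorem sSup_ne_top_eq_ker {Φ : MPos r μ →ₗ⁅ℂ,Witt n⁆ Module.Dual ℂ (MNeg r (-μ))} (hΦ : Φ ≠ 0) :
    sSup {N : LieSubmodule ℂ (Witt n) (MPos r μ) | N ≠ ⊤} = Φ.ker := by
  have hsup := span_singleton_sup_iSup_wtSpace_ne (genPos_mem_wtSpace (r := r) (μ := μ))
    (Ind.lieSpan_gen_eq_top_of_sup_eq_top (nNeg_sup_bPos r))
  refine le_antisymm (sSup_le fun _ ↦ ?_) (le_sSup fun h ↦ ?_)
  · exact le_ker_of_ne_top Φ genPos_mem_wtSpace (lieSpan_genPos r μ) hsup genNeg_mem_wtSpace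
      (lieSpan_genNeg r (-μ))
  · exact hΦ (LieModuleHom.ext fun _ ↦ Φ.mem_ker.1 (h.ge trivial))

theorem exists_injective_LPos_dual (r : Fin n → Fin n → Prop) [IsStrictTotalOrder (Fin n) r]
    (μ : Module.Dual ℂ (torus n)) :
    ∃ j : LPos r μ →ₗ⁅ℂ,Witt n⁆ Module.Dual ℂ (MNeg r (-μ)), Function.Injective j ∧ j ≠ 0 := by
  obtain ⟨Φ, hΦ⟩ := exists_pairing r μ
  have hΦ0 : Φ ≠ 0 := by
    rintro rfl
    exact zero_ne_one hΦ
  obtain ⟨j, hj, hjΦ⟩ := exists_injective_of_eq_ker (sSup_ne_top_eq_ker hΦ0)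
  exact ⟨j, hj, fun h ↦ hΦ0 (LieModuleHom.ext fun m ↦ by rw [← hjΦ m, h]; rfl)⟩

theorem isWeightModule_LPos (r : Fin n → Fin n → Prop) [IsStrictTotalOrder (Fin n) r]
    (μ : Module.Dual ℂ (torus n)) : IsWeightModule n (LPos r μ) :=
  isWeightModule_of_lieSpan_eq_top
    (map_mem_wtSpace (LieSubmodule.Quotient.mk' _) genPos_mem_wtSpace)
    (lieSpan_singleton_eq_top_of_surjective (LieSubmodule.Quotient.surjective_mk' _)
      (lieSpan_genPos r μ))

theorem isWeightModule_MNeg (r : Fin n → Fin n → Prop) [IsStrictTotalOrder (Fin n) r]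
    (μ : Module.Dual ℂ (torus n)) : IsWeightModule n (MNeg r μ) :=
  isWeightModule_of_lieSpan_eq_top genNeg_mem_wtSpace (lieSpan_genNeg r μ)

theorem finite_wtSpace_MNeg (ν : Module.Dual ℂ (torus n)) :
    Module.Finite ℂ (wtSpace (MNeg r μ) ν) :=
  finite_wtSpace genNeg_mem_wtSpace
    (Ind.lieSpan_gen_eq_top_of_sup_eq_top (isCompl_nPos_bNeg r).sup_eq_top) ν

theorem nonempty_completion_LPos_equiv_dual
    (hμ : LieModule.IsIrreducible ℂ (Witt n) (MNeg r (-μ))) :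
    Nonempty (Completion n (LPos r μ) ≃ₗ⁅ℂ,Witt n⁆ Module.Dual ℂ (MNeg r (-μ))) := by
  obtain ⟨j, hj, hj0⟩ := exists_injective_LPos_dual r μ
  refine nonempty_completion_equiv_dual (isWeightModule_LPos r μ) (isWeightModule_MNeg r (-μ))
    finite_wtSpace_MNeg hj fun m hm ↦ ?_
  exact (LieSubmodule.mem_bot m).1 (coannihilator_eq_bot hj0 ▸ mem_coannihilator.2 hm)

theorem finrank_whittaker_completion_LPos
    (hμ : LieModule.IsIrreducible ℂ (Witt n) (MNeg r (-μ)))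
    (χ : LieAlgebra.LieCharacter ℂ (nPos r)) :
    Module.finrank ℂ (whittaker χ (Completion n (LPos r μ))) = 1 := by
  have hdual : Module.finrank ℂ (whittaker χ (Module.Dual ℂ (MNeg r (-μ)))) = 1 :=
    finrank_whittaker_dual (isCompl_nPos_bNeg r) _ χ
  exact (nonempty_completion_LPos_equiv_dual hμ).elim fun E ↦
    (finrank_whittaker_congr χ E).trans hdual

theorem annihilator_eq_annihilator_LPos
    (hμ : LieModule.IsIrreducible ℂ (Witt n) (MNeg r (-μ)))
    {f : V →ₗ⁅ℂ,Witt n⁆ Completion n (LPos r μ)} (hf : Function.Injective f) (hf0 : f ≠ 0) :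
    annihilator (Witt n) V = annihilator (Witt n) (LPos r μ) := by
  obtain ⟨j, hj, hj0⟩ := exists_injective_LPos_dual r μ
  obtain ⟨E⟩ := nonempty_completion_LPos_equiv_dual hμ
  have hEf : E.toLieModuleHom.comp f ≠ 0 := fun h ↦ hf0 <| LieModuleHom.ext fun x ↦
    E.injective ((LieModuleHom.congr_fun h x).trans (map_zero E).symm)
  rw [annihilator_eq_annihilator_dual (f := E.toLieModuleHom.comp f) (E.injective.comp hf) hEf,
    annihilator_eq_annihilator_dual hj hj0]

end HighestWeight

end WittWhittaker

end

open WittWhittaker in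
theorem theorem91 (n : ℕ) (r : Fin n → Fin n → Prop) [IsStrictTotalOrder (Fin n) r]
    (μ : Module.Dual ℂ (WittWhittaker.torus n))
    (hμ : LieModule.IsIrreducible ℂ (WittWhittaker.Witt n) (WittWhittaker.MNeg r (-μ)))
    (lam : LieAlgebra.LieCharacter ℂ (WittWhittaker.nPos r)) :
    -- the space of Whittaker vectors in the completion of `L⁺(μ)`
    (Module.finrank ℂ
        (WittWhittaker.whittaker lam (WittWhittaker.Completion n (WittWhittaker.LPos r μ))) = 1 ∧
      LieModule.IsIrreducible ℂ (WittWhittaker.nPos r)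
        (WittWhittaker.whittaker lam (WittWhittaker.Completion n (WittWhittaker.LPos r μ)))) ∧
    -- the homomorphism that defines `L(λ, μ)` exists and is unique up to a scalar
    Module.finrank ℂ
      (WittWhittaker.MStd r lam →ₗ⁅ℂ, WittWhittaker.Witt n⁆
        WittWhittaker.Completion n (WittWhittaker.LPos r μ)) = 1 ∧
    -- the properties of its image `L(λ, μ)`
    ∀ φ : WittWhittaker.MStd r lam →ₗ⁅ℂ, WittWhittaker.Witt n⁆
        WittWhittaker.Completion n (WittWhittaker.LPos r μ), φ ≠ 0 →
      LieModule.IsIrreducible ℂ (WittWhittaker.Witt n) φ.range ∧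
      Module.finrank ℂ (WittWhittaker.whittaker lam φ.range) = 1 ∧
      WittWhittaker.annihilator (WittWhittaker.Witt n) φ.range =
        WittWhittaker.annihilator (WittWhittaker.Witt n) (WittWhittaker.LPos r μ) := by
  have h1 : Module.finrank ℂ (whittaker lam (Completion n (LPos r μ))) = 1 :=
    finrank_whittaker_completion_LPos hμ lam
  refine ⟨⟨h1, isIrreducible_of_finrank_eq_one h1⟩, (Ind.homEquiv lam).finrank_eq.trans h1,
    fun φ hφ ↦ ⟨Ind.isIrreducible_range span_range_D (lie_D_mem_span_lower r) hφ h1,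
      Ind.finrank_whittaker_range hφ h1, ?_⟩⟩
  have hincl : φ.range.incl ≠ 0 := fun h ↦
    hφ (LieModuleHom.ext fun m ↦ LieModuleHom.congr_fun h ⟨φ m, φ.mem_range_self m⟩)
  exact annihilator_eq_annihilator_LPos hμ Subtype.val_injective hincl
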